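/- **Definitions.** An *orthogonal factorization system* on a category is a pair $(\mathcal L,\mathcal R)$ of classes of morphisms such that (1) both classes are closed under composition and contain all isomorphisms; (2) every morphism is of the form $m\circ e$ with $e\in\mathcal L$, $m\in\mathcal R$; (3) whenever $m\circ p=q\circ e$ with $e:X\to Y$ in $\mathcal L$, $m:X'\to Y'$ in $\mathcal R$ and arbitrary $p:X\to X'$, $q:Y\to Y'$, there is a unique $w:Y\to X'$ with $w\circ e=p$ and $m\circ w=q$. *The category $\mathbf{2\text{-}Cob}$.* Objects are finite sets (of circles). A morphism $m\to n$ is given by a finite set $C$ of components, maps $l_m:m\to C$, $l_n:n\to C$ and a genus function $g:C\to\mathbb N$, up to genus-preserving bijections of $C$ compatible with $l_m$ and $l_n$. The composite of $(A,l_m,l_k,g_1):m\to k$ and $(B,l'_k,l_n,g_2):k\to n$ has as components the pushout $C=A\sqcup_k B$, with maps $\iota_A:A\to C$, $\iota_B:B\to C$, and genus $$g(x)=1+\sum_{a\in A,\ \iota_A(a)=x}(g_1(a)-1)+\sum_{b\in B,\ \iota_B(b)=x}(g_2(b)-1)+\#\{y\in k : y\mapsto x\}.$$ A *cofibration* is a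 cobordism for which $l_n$ is injective and $l_n=l_m\circ u$ for some $u:n\to m$. A *fibration* is a cobordism for which $l_m$ is injective, $l_n$ is surjective and $g\circ l_m=0$. *The category $\mathbf{1\text{-}Cob}^+$.* Objects are finite sets $m=m_+\sqcup m_-$ of points with signs. A morphism $m\to n$ is given by a finite set $C$ and maps $l_m:m\to C$, $l_n:n\to C$ such that the points over each $c\in C$ are either two points of $m$ of opposite signs, or two points of $n$ of opposite signs, or one point of $m$ and one point of $n$ of the same sign, or none (a closed loop), up to bijections of $C$ compatible with $l_m$ and $l_n$. Composition is by pushout. A *cofibration* is a cobordism with no creation ($l_n$ is injective); a *fibration* is a cobordism with no annihilation ($l_m$ is injective) and no closed loops (each $c\in C$ is in the image of $l_m$ or of $l_n$). *The functor $\Phi:\mathbf{1\text{-}Cob}^+\to\mathbf{2\text{-}Cob}$* sends every point to a circle (forgetting the signs), every segment to a component of genus $0$, and every closed loop to a closed surface of genus $1$. **Theorem.** The cofibrations and the fibrations of $\mathbf{2\text{-}Cob}$ form an orthogonal factorization system $(\mathcal L,\mathcal R)$ on $\mathbf{2\text{-}Cob}$, and it induces one on $\mathbf{1\text{-}Cob}^+$: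 the pair $(\Phi^{-1}(\mathcal L),\Phi^{-1}(\mathcal R))$ is an orthogonal factorization system on $\mathbf{1\text{-}Cob}^+$. Here $\Phi^{-1}(\mathcal L)$ is exactly the class of cofibrations and $\Phi^{-1}(\mathcal R)$ exactly the class of fibrations of $\mathbf{1\text{-}Cob}^+$. Moreover, $\Phi$ is faithful, and factorizations of images stay in the image: if $f:M\to N$ is a morphism of $\mathbf{1\text{-}Cob}^+$ and $\Phi(f)=m\circ e$ with a cofibration $e:\Phi(M)\to K$ and a fibration $m:K\to\Phi(N)$, then there are morphisms $e':M\to K'$, $m':K'\to N$ of $\mathbf{1\text{-}Cob}^+$ and an isomorphism $i:K\to\Phi(K')$ with $f=m'\circ e'$, $\Phi(e')=i\circ e$ and $\Phi(m')=m\circ i^{-1}$. -/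

import Mathlib

universe v u

open CategoryTheory

namespace Cob

/-! ## Orthogonal factorization systems -/

/-- `(L, R)` is an orthogonal factorization system: both classes are closed under composition and
contain all isomorphisms, every morphism is an `L`-morphism followed by an `R`-morphism, and every
commutative square from an `L`-morphism to an `R`-morphism has exactly one diagonal filler. -/
structure IsOrthogonalFactorizationSystem {C : Type u} [Category.{v} C]
    (L R : MorphismProperty C) : Prop where
  left_comp : ∀ {X Y Z : C} (f : X ⟶ Y) (g : Y ⟶ Z), L f → L g → L (f ≫ g)
  right_comp : ∀ {X Y Z : C} (f : X ⟶ Y) (g : Y ⟶ Z), R f → R g → R (f ≫ g)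
  left_iso : ∀ {X Y : C} (f : X ⟶ Y), IsIso f → L f
  right_iso : ∀ {X Y : C} (f : X ⟶ Y), IsIso f → R f
  factor : ∀ {X Y : C} (f : X ⟶ Y),
    ∃ (Z : C) (e : X ⟶ Z) (m : Z ⟶ Y), L e ∧ R m ∧ e ≫ m = f
  lift : ∀ {X Y X' Y' : C} (e : X ⟶ Y) (m : X' ⟶ Y') (p : X ⟶ X') (q : Y ⟶ Y'),
    L e → R m → p ≫ m = e ≫ q → ∃! w : Y ⟶ X', e ≫ w = p ∧ w ≫ m = q

/-! ## Sums over the fibres of a map -/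

/-- The sum of `e a` over all `a` with `f a = x` (used for finite `α` only). -/
noncomputable def fiberSum {α β : Type*} (f : α → β) (e : α → ℤ) (x : β) : ℤ :=
  ∑ᶠ a ∈ f ⁻¹' {x}, e a

section fiberSum

variable {α β γ : Type*}

open Classical in
theorem fiberSum_eq [Fintype α] (f : α → β) (e : α → ℤ) (x : β) :
    fiberSum f e x = ∑ a, if f a = x then e a else 0 := by
  unfold fiberSum
  rw [finsum_mem_def, finsum_eq_sum_of_fintype]
  refine Finset.sum_congr rfl fun a _ => ?_
  simp [Set.indicator]

theorem fiberSum_comp [Finite α] [Finite β] (f : α → β) (g : β → γ) (e : α → ℤ) :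
    fiberSum g (fiberSum f e) = fiberSum (g ∘ f) e := by
  classical
  have := Fintype.ofFinite α
  have := Fintype.ofFinite β
  funext x
  simp only [fiberSum_eq, ← Finset.sum_filter]
  rw [← Finset.sum_fiberwise_of_maps_to (s := Finset.univ.filter fun a => (g ∘ f) a = x)
    (t := Finset.univ.filter fun b => g b = x) (g := f) (by simp)]
  refine Finset.sum_congr rfl fun b hb => Finset.sum_congr ?_ fun _ _ => rfl
  ext a
  simp only [Finset.mem_filter, Finset.mem_univ, true_and] at hb ⊢
  constructor
  · rintro rfl; exact ⟨hb, rfl⟩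
  · exact fun h => h.2

theorem fiberSum_add [Finite α] (f : α → β) (e e' : α → ℤ) :
    fiberSum f (e + e') = fiberSum f e + fiberSum f e' := by
  classical
  have := Fintype.ofFinite α
  funext x
  simp only [fiberSum_eq, Pi.add_apply, ← Finset.sum_add_distrib]
  refine Finset.sum_congr rfl fun a _ => ?_
  split_ifs <;> simp

theorem fiberSum_smul [Finite α] (f : α → β) (n : ℤ) (e : α → ℤ) :
    fiberSum f (n • e) = n • fiberSum f e := by
  classical
  have := Fintype.ofFinite α
  funext x
  simp only [fiberSum_eq, Pi.smul_apply, smul_eq_mul, Finset.mul_sum]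
  refine Finset.sum_congr rfl fun a _ => ?_
  split_ifs <;> simp

theorem fiberSum_mono [Finite α] (f : α → β) {e e' : α → ℤ} (h : ∀ a, e a ≤ e' a) (x : β) :
    fiberSum f e x ≤ fiberSum f e' x := by
  classical
  have := Fintype.ofFinite α
  simp only [fiberSum_eq]
  refine Finset.sum_le_sum fun a _ => ?_
  split_ifs
  · exact h a
  · exact le_rfl

/-- Reindexing the source and the target of the map along bijections. -/
theorem fiberSum_congr {α' β' : Type*} (σ : α ≃ α') (τ : β ≃ β') (f : α → β) (f' : α' → β')
    (e : α → ℤ) (e' : α' → ℤ) (hf : ∀ a, f' (σ a) = τ (f a)) (he : ∀ a, e' (σ a) = e a) (x : β) :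
    fiberSum f' e' (τ x) = fiberSum f e x := by
  classical
  unfold fiberSum
  simp only [finsum_mem_def]
  rw [← finsum_comp_equiv σ]
  refine finsum_congr fun a => ?_
  simp [Set.indicator_apply, hf, he]

theorem fiberSum_right {β' : Type*} (τ : β ≃ β') (f : α → β) (f' : α → β') (e : α → ℤ)
    (hf : ∀ a, f' a = τ (f a)) (x : β) : fiberSum f' e (τ x) = fiberSum f e x :=
  fiberSum_congr (Equiv.refl α) τ f f' e e hf (fun _ => rfl) x

theorem fiberSum_id (e : α → ℤ) : fiberSum id e = e := by
  funext x
  simp [fiberSum]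

theorem fiberSum_one [Finite α] (f : α → β) (x : β) :
    fiberSum f 1 x = ((f ⁻¹' {x}).ncard : ℤ) := by
  classical
  have := Fintype.ofFinite α
  rw [fiberSum_eq, Set.ncard_eq_toFinset_card']
  simp

end fiberSum

/-! ## Gluing two sets of components along a set of boundary points -/

section Glue

variable {k A B : Type u}

/-- The relation identifying `f z` with `g z` for all `z : k`. -/
inductive GlueRel (f : k → A) (g : k → B) : A ⊕ B → A ⊕ B → Prop
  | glue (z : k) : GlueRel f g (Sum.inl (f z)) (Sum.inr (g z))

/-- The pushout of sets of `f : k → A` and `g : k → B`: the quotient of the disjoint union of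
`A` and `B` by the equivalence relation generated by `f z ∼ g z`. -/
def Glue (f : k → A) (g : k → B) : Type u := Quot (GlueRel f g)

namespace Glue

variable {f : k → A} {g : k → B}

/-- The canonical map from the left set to the pushout. -/
def inl (f : k → A) (g : k → B) (a : A) : Glue f g := Quot.mk _ (Sum.inl a)

/-- The canonical map from the right set to the pushout. -/
def inr (f : k → A) (g : k → B) (b : B) : Glue f g := Quot.mk _ (Sum.inr b)

theorem condition (f : k → A) (g : k → B) (z : k) : inl f g (f z) = inr f g (g z) :=
  Quot.sound (GlueRel.glue z)

theorem ind {P : Glue f g → Prop} (hl : ∀ a, P (inl f g a)) (hr : ∀ b, P (inr f g b)) (x) : P x := by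
  induction x using Quot.ind with
  | mk y => cases y with
    | inl a => exact hl a
    | inr b => exact hr b

/-- The map out of the pushout given by a compatible pair of maps. -/
def desc {X : Type*} (p : A → X) (q : B → X) (h : ∀ z, p (f z) = q (g z)) : Glue f g → X :=
  Quot.lift (Sum.elim p q) (by rintro _ _ ⟨z⟩; exact h z)

@[simp] theorem desc_inl {X : Type*} (p : A → X) (q : B → X) (h : ∀ z, p (f z) = q (g z)) (a : A) :
    desc p q h (inl f g a) = p a := rfl

@[simp] theorem desc_inr {X : Type*} (p : A → X) (q : B → X) (h : ∀ z, p (f z) = q (g z)) (b : B) :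
    desc p q h (inr f g b) = q b := rfl

instance [Finite A] [Finite B] : Finite (Glue f g) :=
  inferInstanceAs (Finite (Quot (GlueRel f g)))

/-- The map between pushouts induced by bijections of the glued sets. -/
def congr {A' B' : Type u} {f' : k → A'} {g' : k → B'} (σ : A ≃ A') (τ : B ≃ B')
    (hf : ∀ z, σ (f z) = f' z) (hg : ∀ z, τ (g z) = g' z) : Glue f g ≃ Glue f' g' where
  toFun := desc (fun a => inl f' g' (σ a)) (fun b => inr f' g' (τ b))
    (fun z => by rw [hf, hg, condition])
  invFun := desc (fun a => inl f g (σ.symm a)) (fun b => inr f g (τ.symm b))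
    (fun z => by rw [← hf, ← hg, σ.symm_apply_apply, τ.symm_apply_apply, condition])
  left_inv := ind (fun a => by simp) (fun b => by simp)
  right_inv := ind (fun a => by simp) (fun b => by simp)

/-- Associativity of gluing. -/
def assoc {l C : Type u} (f : k → A) (g : k → B) (f' : l → B) (g' : l → C) :
    Glue (fun z => inr f g (f' z)) g' ≃ Glue f (fun z => inl f' g' (g z)) where
  toFun := desc
    (desc (inl _ _) (fun b => inr _ _ (inl _ _ b)) (fun z => condition _ _ z))
    (fun c => inr _ _ (inr _ _ c))
    (fun z => by rw [desc_inr, condition])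
  invFun := desc
    (fun a => inl _ _ (inl _ _ a))
    (desc (fun b => inl _ _ (inr _ _ b)) (inr _ _) (fun z => condition _ _ z))
    (fun z => by rw [desc_inl, condition])
  left_inv := ind (ind (fun _ => rfl) (fun _ => rfl)) (fun _ => rfl)
  right_inv := ind (fun _ => rfl) (ind (fun _ => rfl) (fun _ => rfl))

/-- Gluing with the identity on the left. -/
def idLeft (g : k → B) : Glue (id : k → k) g ≃ B where
  toFun := desc g id (fun _ => rfl)
  invFun := inr _ _
  left_inv := ind (fun z => (condition id g z).symm) (fun _ => rfl)
  right_inv _ := rfl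

/-- Gluing with the identity on the right. -/
def idRight (f : k → A) : Glue f (id : k → k) ≃ A where
  toFun := desc id f (fun _ => rfl)
  invFun := inl _ _
  left_inv := ind (fun _ => rfl) (fun z => condition f id z)
  right_inv _ := rfl

/-- A connected graph with `t` vertices and `s` edges satisfies `t ≤ s + 1`: for every point `x` of
the pushout, the number of components that make up `x` is at most one more than the number of
boundary points along which they are glued. -/
theorem card_fiber_le [Finite k] [Finite A] [Finite B] (f : k → A) (g : k → B) (x : Glue f g) :
    fiberSum (inl f g) 1 x + fiberSum (inr f g) 1 x ≤ fiberSum (inl f g ∘ f) 1 x + 1 := by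
  classical
  have := Fintype.ofFinite k
  have := Fintype.ofFinite A
  have := Fintype.ofFinite B
  let VA := {a : A // inl f g a = x}
  let VB := {b : B // inr f g b = x}
  let E := {z : k // inl f g (f z) = x}
  let T : ((VA → ℚ) × (VB → ℚ)) →ₗ[ℚ] (E → ℚ) :=
    { toFun := fun h z => h.1 ⟨f z.1, z.2⟩ - h.2 ⟨g z.1, by rw [← condition]; exact z.2⟩
      map_add' := fun h h' => by funext z; simp; ring
      map_smul' := fun c h => by funext z; simp; ring }
  have hker : LinearMap.ker T ≤
      Submodule.span ℚ {((fun _ => 1, fun _ => 1) : (VA → ℚ) × (VB → ℚ))} := by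
    intro h hh
    rw [LinearMap.mem_ker] at hh
    obtain ⟨ext, hextl, hextr⟩ : ∃ ext : Glue f g → ℚ,
        (∀ a, ext (inl f g a) = if ha : inl f g a = x then h.1 ⟨a, ha⟩ else 0) ∧
        (∀ b, ext (inr f g b) = if hb : inr f g b = x then h.2 ⟨b, hb⟩ else 0) := ⟨desc
      (fun a => if ha : inl f g a = x then h.1 ⟨a, ha⟩ else 0)
      (fun b => if hb : inr f g b = x then h.2 ⟨b, hb⟩ else 0)
      (fun z => by
        by_cases hz : inl f g (f z) = x
        · have h1 := congrFun hh ⟨z, hz⟩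
          have hz' : inr f g (g z) = x := by rw [← condition]; exact hz
          simp only [hz, hz', dif_pos]
          exact sub_eq_zero.mp h1
        · have hz' : ¬ inr f g (g z) = x := by rw [← condition]; exact hz
          simp only [hz, hz', dif_neg, not_false_iff]), fun a => rfl, fun b => rfl⟩
    rw [Submodule.mem_span_singleton]
    refine ⟨ext x, ?_⟩
    refine Prod.ext (funext fun a => ?_) (funext fun b => ?_)
    · have : ext (inl f g a.1) = h.1 a := by rw [hextl, dif_pos a.2]
      rw [a.2] at this
      simpa using this
    · have : ext (inr f g b.1) = h.2 b := by rw [hextr, dif_pos b.2]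
      rw [b.2] at this
      simpa using this
  have h0 := finrank_span_le_card (R := ℚ) ({(fun _ => 1, fun _ => 1)} : Set ((VA → ℚ) × (VB → ℚ)))
  rw [Set.toFinset_singleton, Finset.card_singleton] at h0
  have h1 : Module.finrank ℚ (LinearMap.ker T) ≤ 1 := (Submodule.finrank_mono hker).trans h0
  have h2 := LinearMap.finrank_range_add_finrank_ker T
  have h3 : Module.finrank ℚ (LinearMap.range T) ≤ Fintype.card E := by
    have := Submodule.finrank_le (LinearMap.range T)
    rwa [Module.finrank_fintype_fun_eq_card] at this
  rw [Module.finrank_prod, Module.finrank_fintype_fun_eq_card,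
    Module.finrank_fintype_fun_eq_card] at h2
  have key : Fintype.card VA + Fintype.card VB ≤ Fintype.card E + 1 := by omega
  simp only [fiberSum_eq, Pi.one_apply, Finset.sum_boole, Function.comp]
  rw [Fintype.card_subtype, Fintype.card_subtype, Fintype.card_subtype] at key
  exact_mod_cast key

end Glue

end Glue

/-! ## The category of two-dimensional cobordisms -/

/-- A surface cobordism from `∐_{m} S¹` to `∐_{n} S¹`: a finite set of connected components, the
component of every incoming and every outgoing boundary circle, and the genus of every component. -/
structure Surface (m n : Type u) where
  comp : Type u
  [finite : Finite comp]
  lin : m → comp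
  lout : n → comp
  genus : comp → ℕ

namespace Surface

attribute [instance] Surface.finite

variable {m n k l : Type u}

/-- Two surface cobordisms with the same boundary are identified if there is a genus preserving
bijection between their sets of components that is compatible with the boundary circles. -/
def Equivalent (φ ψ : Surface m n) : Prop :=
  ∃ χ : φ.comp ≃ ψ.comp, (∀ x, χ (φ.lin x) = ψ.lin x) ∧ (∀ y, χ (φ.lout y) = ψ.lout y) ∧
    ∀ c, ψ.genus (χ c) = φ.genus c

theorem Equivalent.refl (φ : Surface m n) : φ.Equivalent φ :=
  ⟨Equiv.refl _, fun _ => rfl, fun _ => rfl, fun _ => rfl⟩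

theorem Equivalent.symm {φ ψ : Surface m n} : φ.Equivalent ψ → ψ.Equivalent φ := by
  rintro ⟨χ, h1, h2, h3⟩
  exact ⟨χ.symm, fun x => by rw [← h1, χ.symm_apply_apply],
    fun y => by rw [← h2, χ.symm_apply_apply], fun c => by rw [← h3, χ.apply_symm_apply]⟩

theorem Equivalent.trans {φ ψ θ : Surface m n} :
    φ.Equivalent ψ → ψ.Equivalent θ → φ.Equivalent θ := by
  rintro ⟨χ, h1, h2, h3⟩ ⟨χ', h1', h2', h3'⟩
  exact ⟨χ.trans χ', fun x => by simp [h1, h1'], fun y => by simp [h2, h2'],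
    fun c => by simp [h3, h3']⟩

instance setoid (m n : Type u) : Setoid (Surface m n) where
  r := Equivalent
  iseqv := ⟨Equivalent.refl, Equivalent.symm, Equivalent.trans⟩

/-- The cylinder. -/
abbrev id (m : Type u) [Finite m] : Surface m m where
  comp := m
  lin := _root_.id
  lout := _root_.id
  genus _ := 0

/-- The set of components of a composition. -/
abbrev GlueComp (φ : Surface m k) (ψ : Surface k n) : Type u := Glue φ.lout ψ.lin

/-- The genus of the component `x` of a composition: each of the glued components `c` contributes
`genus c - 1`, and each circle along which they are glued contributes `1`. -/
noncomputable def glueGenus (φ : Surface m k) (ψ : Surface k n) (x : GlueComp φ ψ) : ℤ :=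
  1 + fiberSum (Glue.inl φ.lout ψ.lin) (fun a => (φ.genus a : ℤ) - 1) x
    + fiberSum (Glue.inr φ.lout ψ.lin) (fun b => (ψ.genus b : ℤ) - 1) x
    + fiberSum (fun z => Glue.inl φ.lout ψ.lin (φ.lout z)) (fun _ => 1) x

theorem glueGenus_nonneg [Finite k] (φ : Surface m k) (ψ : Surface k n) (x : GlueComp φ ψ) :
    0 ≤ glueGenus φ ψ x := by
  have h := Glue.card_fiber_le φ.lout ψ.lin x
  have h1 := fiberSum_mono (Glue.inl φ.lout ψ.lin) (e := (-1 : ℤ) • 1)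
    (e' := fun a => (φ.genus a : ℤ) - 1) (by intro a; simp only [Pi.smul_apply, Pi.one_apply, smul_eq_mul]; omega) x
  have h2 := fiberSum_mono (Glue.inr φ.lout ψ.lin) (e := (-1 : ℤ) • 1)
    (e' := fun a => (ψ.genus a : ℤ) - 1) (by intro a; simp only [Pi.smul_apply, Pi.one_apply, smul_eq_mul]; omega) x
  rw [fiberSum_smul] at h1 h2
  simp only [Pi.smul_apply, smul_eq_mul] at h1 h2
  have h3 : fiberSum (fun z => Glue.inl φ.lout ψ.lin (φ.lout z)) (fun _ => 1) x
    = fiberSum (Glue.inl φ.lout ψ.lin ∘ φ.lout) 1 x := rfl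
  unfold glueGenus
  linarith

/-- Composition by gluing. The integer `glueGenus` is nonnegative, so `toNat` loses nothing. -/
noncomputable abbrev trans (φ : Surface m k) (ψ : Surface k n) : Surface m n where
  comp := GlueComp φ ψ
  lin x := Glue.inl _ _ (φ.lin x)
  lout y := Glue.inr _ _ (ψ.lout y)
  genus x := (glueGenus φ ψ x).toNat

/-- The genus of a component minus one. -/
def excess (φ : Surface m n) (c : φ.comp) : ℤ := (φ.genus c : ℤ) - 1

theorem excess_trans [Finite k] (φ : Surface m k) (ψ : Surface k n) :
    (φ.trans ψ).excess = fiberSum (Glue.inl φ.lout ψ.lin) φ.excess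
      + fiberSum (Glue.inr φ.lout ψ.lin) ψ.excess
      + fiberSum (Glue.inl φ.lout ψ.lin ∘ φ.lout) 1 := by
  funext x
  change (((glueGenus φ ψ x).toNat : ℕ) : ℤ) - 1 = _
  rw [Int.toNat_of_nonneg (glueGenus_nonneg φ ψ x)]
  simp only [Pi.add_apply]
  unfold glueGenus
  change 1 + fiberSum _ φ.excess x + fiberSum _ ψ.excess x
    + fiberSum (Glue.inl φ.lout ψ.lin ∘ φ.lout) 1 x - 1 = _
  ring

theorem equivalent_of_excess {φ ψ : Surface m n} (χ : φ.comp ≃ ψ.comp)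
    (h1 : ∀ x, χ (φ.lin x) = ψ.lin x) (h2 : ∀ y, χ (φ.lout y) = ψ.lout y)
    (h3 : ∀ c, ψ.excess (χ c) = φ.excess c) : φ.Equivalent ψ :=
  ⟨χ, h1, h2, fun c => by have := h3 c; unfold excess at this; omega⟩

theorem trans_congr [Finite k] {φ φ' : Surface m k} {ψ ψ' : Surface k n} :
    φ.Equivalent φ' → ψ.Equivalent ψ' → (φ.trans ψ).Equivalent (φ'.trans ψ') := by
  rintro ⟨σ, h1, h2, h3⟩ ⟨τ, h1', h2', h3'⟩
  refine equivalent_of_excess (Glue.congr σ τ h2 h1') (fun x => ?_) (fun y => ?_) fun c => ?_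
  · change Glue.inl _ _ (σ (φ.lin x)) = _
    rw [h1]
  · change Glue.inr _ _ (τ (ψ.lout y)) = _
    rw [h2']
  · rw [excess_trans, excess_trans]
    simp only [Pi.add_apply]
    congr 1
    · congr 1
      · exact fiberSum_congr σ (Glue.congr σ τ h2 h1') _ _ φ.excess φ'.excess (fun a => rfl)
          (fun a => by simp [excess, h3]) c
      · exact fiberSum_congr τ (Glue.congr σ τ h2 h1') _ _ ψ.excess ψ'.excess (fun a => rfl)
          (fun a => by simp [excess, h3']) c
    · refine fiberSum_congr (Equiv.refl k) _ _ _ _ _ (fun a => ?_) (fun a => rfl) c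
      change Glue.inl _ _ (φ'.lout a) = Glue.inl _ _ (σ (φ.lout a))
      rw [h2]

theorem id_trans [Finite m] (φ : Surface m n) : ((Surface.id m).trans φ).Equivalent φ := by
  refine equivalent_of_excess (Glue.idLeft φ.lin) (fun x => rfl) (fun y => rfl) fun c => ?_
  obtain ⟨b, rfl⟩ := (Glue.idLeft φ.lin).symm.surjective c
  rw [Equiv.apply_symm_apply, excess_trans]
  have e1 : (Surface.id m).excess = (-1 : ℤ) • 1 := by funext x; simp [excess, Surface.id]
  have e2 : fiberSum (Glue.inr (Surface.id m).lout φ.lin) φ.excess ((Glue.idLeft φ.lin).symm b)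
      = φ.excess b := by
    rw [← congrFun (fiberSum_id φ.excess) b]
    exact fiberSum_congr (Equiv.refl _) (Glue.idLeft φ.lin).symm _ _ _ _ (fun _ => rfl)
      (fun _ => rfl) b
  simp only [Pi.add_apply]
  rw [e2, e1, fiberSum_smul]
  change _ = _ + _ + fiberSum (Glue.inl (Surface.id m).lout φ.lin) 1 _
  simp

theorem trans_id [Finite n] (φ : Surface m n) : (φ.trans (Surface.id n)).Equivalent φ := by
  refine equivalent_of_excess (Glue.idRight φ.lout) (fun x => rfl) (fun y => rfl) fun c => ?_
  obtain ⟨b, rfl⟩ := (Glue.idRight φ.lout).symm.surjective c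
  rw [Equiv.apply_symm_apply, excess_trans]
  have e1 : (Surface.id n).excess = (-1 : ℤ) • 1 := by funext x; simp [excess, Surface.id]
  have e2 : fiberSum (Glue.inl φ.lout (Surface.id n).lin) φ.excess ((Glue.idRight φ.lout).symm b)
      = φ.excess b := by
    rw [← congrFun (fiberSum_id φ.excess) b]
    exact fiberSum_congr (Equiv.refl _) (Glue.idRight φ.lout).symm _ _ _ _ (fun _ => rfl)
      (fun _ => rfl) b
  have e3 : Glue.inl φ.lout (Surface.id n).lin ∘ φ.lout = Glue.inr φ.lout (Surface.id n).lin :=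
    funext fun z => Glue.condition φ.lout (Surface.id n).lin z
  simp only [Pi.add_apply]
  rw [e2, e1, fiberSum_smul, e3]
  simp

theorem assoc [Finite k] [Finite l] (φ : Surface m k) (ψ : Surface k l) (θ : Surface l n) :
    ((φ.trans ψ).trans θ).Equivalent (φ.trans (ψ.trans θ)) := by
  let σ : ((φ.trans ψ).trans θ).comp ≃ (φ.trans (ψ.trans θ)).comp :=
    Glue.assoc φ.lout ψ.lin ψ.lout θ.lin
  refine equivalent_of_excess σ (fun x => rfl) (fun y => rfl) fun c => ?_
  rw [excess_trans φ (ψ.trans θ), excess_trans (φ.trans ψ) θ, excess_trans φ ψ, excess_trans ψ θ]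
  simp only [fiberSum_add, Pi.add_apply]
  have hA : fiberSum (Glue.inl φ.lout (ψ.trans θ).lin) φ.excess (σ c)
      = fiberSum (Glue.inl (φ.trans ψ).lout θ.lin) (fiberSum (Glue.inl φ.lout ψ.lin) φ.excess) c := by
    rw [fiberSum_comp]
    exact fiberSum_right σ _ _ _ (fun _ => by rfl) c
  have hB : fiberSum (Glue.inr φ.lout (ψ.trans θ).lin)
        (fiberSum (Glue.inl ψ.lout θ.lin) ψ.excess) (σ c)
      = fiberSum (Glue.inl (φ.trans ψ).lout θ.lin) (fiberSum (Glue.inr φ.lout ψ.lin) ψ.excess) c := by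
    rw [fiberSum_comp, fiberSum_comp]
    exact fiberSum_right σ _ _ _ (fun _ => by rfl) c
  have hC : fiberSum (Glue.inr φ.lout (ψ.trans θ).lin)
        (fiberSum (Glue.inr ψ.lout θ.lin) θ.excess) (σ c)
      = fiberSum (Glue.inr (φ.trans ψ).lout θ.lin) θ.excess c := by
    rw [fiberSum_comp]
    exact fiberSum_right σ _ _ _ (fun _ => by rfl) c
  have hk : fiberSum (Glue.inl φ.lout (ψ.trans θ).lin ∘ φ.lout) 1 (σ c)
      = fiberSum (Glue.inl (φ.trans ψ).lout θ.lin)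
          (fiberSum (Glue.inl φ.lout ψ.lin ∘ φ.lout) 1) c := by
    rw [fiberSum_comp]
    exact fiberSum_right σ _ _ _ (fun _ => by rfl) c
  have hl : fiberSum (Glue.inr φ.lout (ψ.trans θ).lin)
        (fiberSum (Glue.inl ψ.lout θ.lin ∘ ψ.lout) 1) (σ c)
      = fiberSum (Glue.inl (φ.trans ψ).lout θ.lin ∘ (φ.trans ψ).lout) 1 c := by
    rw [fiberSum_comp]
    exact fiberSum_right σ _ _ _ (fun _ => by rfl) c
  rw [hA, hB, hC, hk, hl]
  ring

/-- A cofibration: `lout` is injective and factors through `lin`. -/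
def IsCofibration (φ : Surface m n) : Prop :=
  Function.Injective φ.lout ∧ ∃ u : n → m, φ.lout = φ.lin ∘ u

/-- A fibration: `lin` is injective, `lout` is surjective, and every component with an incoming
circle has genus zero. -/
def IsFibration (φ : Surface m n) : Prop :=
  Function.Injective φ.lin ∧ Function.Surjective φ.lout ∧ ∀ x, φ.genus (φ.lin x) = 0

theorem IsCofibration.congr {φ ψ : Surface m n} (h : φ.Equivalent ψ) (hφ : φ.IsCofibration) :
    ψ.IsCofibration := by
  obtain ⟨χ, h1, h2, h3⟩ := h
  obtain ⟨hi, u, hu⟩ := hφ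
  refine ⟨fun x y hxy => hi (χ.injective ?_), u, funext fun y => ?_⟩
  · rw [h2, h2, hxy]
  · rw [← h2, hu, Function.comp, Function.comp, h1]

theorem IsFibration.congr {φ ψ : Surface m n} (h : φ.Equivalent ψ) (hφ : φ.IsFibration) :
    ψ.IsFibration := by
  obtain ⟨χ, h1, h2, h3⟩ := h
  obtain ⟨hi, hs, hg⟩ := hφ
  refine ⟨fun x y hxy => hi (χ.injective ?_), fun c => ?_, fun x => ?_⟩
  · rw [h1, h1, hxy]
  · obtain ⟨y, hy⟩ := hs (χ.symm c)
    exact ⟨y, by rw [← h2, hy, χ.apply_symm_apply]⟩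
  · rw [← h1, h3, hg]

end Surface

/-- An object of the category of two-dimensional cobordisms: a finite set of circles. -/
structure TwoCob where
  circles : Type u
  [finite : Finite circles]

namespace TwoCob

attribute [instance] TwoCob.finite

/-- Morphisms are surface cobordisms up to equivalence relative to the boundary circles;
composition is gluing. -/
noncomputable instance : Category.{u + 1} TwoCob.{u} where
  Hom X Y := Quotient (Surface.setoid X.circles Y.circles)
  id X := ⟦Surface.id X.circles⟧
  comp f g := Quotient.map₂ Surface.trans
    (fun _ _ h _ _ h' => Surface.trans_congr h h') f g
  id_comp f := by
    induction f using Quotient.inductionOn with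
    | h φ => exact Quotient.sound (Surface.id_trans φ)
  comp_id f := by
    induction f using Quotient.inductionOn with
    | h φ => exact Quotient.sound (Surface.trans_id φ)
  assoc f g h := by
    induction f using Quotient.inductionOn with
    | h φ => induction g using Quotient.inductionOn with
      | h ψ => induction h using Quotient.inductionOn with
        | h θ => exact Quotient.sound (Surface.assoc φ ψ θ)

/-- The class of cofibrations. -/
def cofibrations : MorphismProperty TwoCob.{u} := fun X Y f =>
  Quotient.lift (s := Surface.setoid X.circles Y.circles) Surface.IsCofibration
    (fun _ _ h => propext ⟨Surface.IsCofibration.congr h,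
      Surface.IsCofibration.congr (Surface.Equivalent.symm h)⟩) f

/-- The class of fibrations. -/
def fibrations : MorphismProperty TwoCob.{u} := fun X Y f =>
  Quotient.lift (s := Surface.setoid X.circles Y.circles) Surface.IsFibration
    (fun _ _ h => propext ⟨Surface.IsFibration.congr h,
      Surface.IsFibration.congr (Surface.Equivalent.symm h)⟩) f

end TwoCob

/-! ## The category of oriented one-dimensional cobordisms -/

/-- The orientation of a point. -/
inductive Sign : Type
  | plus
  | minus

/-- The numerical value of an orientation. -/
def Sign.val : Sign → ℤ
  | plus => 1
  | minus => -1

/-- An object of the category of oriented one-dimensional cobordisms: a finite set of points, each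
of which is positively or negatively oriented. -/
structure OneCob where
  points : Type u
  [finite : Finite points]
  sign : points → Sign

attribute [instance] OneCob.finite

/-- The possible boundaries of a component `c` of an oriented one-dimensional cobordism: it is a
segment joining two incoming points of opposite signs, or two outgoing points of opposite signs, or
an incoming and an outgoing point of the same sign (positive or negative), or a closed loop. -/
def OrientedAt (M N : OneCob.{u}) {C : Type u} (lin : M.points → C) (lout : N.points → C)
    (c : C) : Prop :=
  (∃ a b, M.sign a = Sign.plus ∧ M.sign b = Sign.minus ∧
    lin ⁻¹' {c} = {a, b} ∧ lout ⁻¹' {c} = ∅) ∨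
  (∃ a b, N.sign a = Sign.plus ∧ N.sign b = Sign.minus ∧
    lin ⁻¹' {c} = ∅ ∧ lout ⁻¹' {c} = {a, b}) ∨
  (∃ a b, M.sign a = Sign.plus ∧ N.sign b = Sign.plus ∧
    lin ⁻¹' {c} = {a} ∧ lout ⁻¹' {c} = {b}) ∨
  (∃ a b, M.sign a = Sign.minus ∧ N.sign b = Sign.minus ∧
    lin ⁻¹' {c} = {a} ∧ lout ⁻¹' {c} = {b}) ∨
  (lin ⁻¹' {c} = ∅ ∧ lout ⁻¹' {c} = ∅)

/-- The signed number of points over `c`. -/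
noncomputable def OneCob.signSum (M : OneCob.{u}) {C : Type u} (f : M.points → C) : C → ℤ :=
  fiberSum f (fun a => (M.sign a).val)

theorem fiberSum_of_empty {α β : Type*} {f : α → β} {x : β} (h : f ⁻¹' {x} = ∅) (e : α → ℤ) :
    fiberSum f e x = 0 := by
  unfold fiberSum; rw [h, finsum_mem_empty]

theorem fiberSum_of_single {α β : Type*} {f : α → β} {x : β} {a : α} (h : f ⁻¹' {x} = {a})
    (e : α → ℤ) : fiberSum f e x = e a := by
  unfold fiberSum; rw [h, finsum_mem_singleton]

theorem fiberSum_of_pair {α β : Type*} {f : α → β} {x : β} {a b : α} (hab : a ≠ b)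
    (h : f ⁻¹' {x} = {a, b}) (e : α → ℤ) : fiberSum f e x = e a + e b := by
  unfold fiberSum; rw [h, finsum_mem_pair hab]

/-- A numerical form of the condition on the boundary of a component. -/
theorem orientedAt_iff (M N : OneCob.{u}) {C : Type u} (lin : M.points → C) (lout : N.points → C)
    (c : C) : OrientedAt M N lin lout c ↔
      (fiberSum lin 1 c + fiberSum lout 1 c = 0 ∨ fiberSum lin 1 c + fiberSum lout 1 c = 2) ∧
        M.signSum lin c = N.signSum lout c := by
  unfold OneCob.signSum
  constructor
  · rintro (⟨a, b, ha, hb, h1, h2⟩ | ⟨a, b, ha, hb, h1, h2⟩ | ⟨a, b, ha, hb, h1, h2⟩ |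
      ⟨a, b, ha, hb, h1, h2⟩ | ⟨h1, h2⟩)
    · have hab : a ≠ b := by rintro rfl; rw [ha] at hb; cases hb
      simp only [fiberSum_of_pair hab h1, fiberSum_of_empty h2, ha, hb]
      simp [Sign.val]
    · have hab : a ≠ b := by rintro rfl; rw [ha] at hb; cases hb
      simp only [fiberSum_of_pair hab h2, fiberSum_of_empty h1, ha, hb]
      simp [Sign.val]
    · simp only [fiberSum_of_single h1, fiberSum_of_single h2, ha, hb]
      simp
    · simp only [fiberSum_of_single h1, fiberSum_of_single h2, ha, hb]
      simp
    · simp only [fiberSum_of_empty h1, fiberSum_of_empty h2]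
      simp
  · rintro ⟨hd, hs⟩
    have e1 := fiberSum_one lin c
    have e2 := fiberSum_one lout c
    rw [e1, e2] at hd
    have hcases : ((lin ⁻¹' {c}).ncard = 0 ∧ (lout ⁻¹' {c}).ncard = 0) ∨
        ((lin ⁻¹' {c}).ncard = 2 ∧ (lout ⁻¹' {c}).ncard = 0) ∨
        ((lin ⁻¹' {c}).ncard = 0 ∧ (lout ⁻¹' {c}).ncard = 2) ∨
        ((lin ⁻¹' {c}).ncard = 1 ∧ (lout ⁻¹' {c}).ncard = 1) := by omega
    rcases hcases with ⟨h1, h2⟩ | ⟨h1, h2⟩ | ⟨h1, h2⟩ | ⟨h1, h2⟩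
    · rw [Set.ncard_eq_zero] at h1 h2
      exact Or.inr (Or.inr (Or.inr (Or.inr ⟨h1, h2⟩)))
    · rw [Set.ncard_eq_zero] at h2
      obtain ⟨a, b, hab, h1⟩ := Set.ncard_eq_two.mp h1
      rw [fiberSum_of_pair hab h1, fiberSum_of_empty h2] at hs
      refine Or.inl ?_
      rcases ha : M.sign a <;> rcases hb : M.sign b <;> simp [ha, hb, Sign.val] at hs
      · exact ⟨a, b, ha, hb, h1, h2⟩
      · exact ⟨b, a, hb, ha, by rw [h1, Set.pair_comm], h2⟩
    · rw [Set.ncard_eq_zero] at h1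
      obtain ⟨a, b, hab, h2⟩ := Set.ncard_eq_two.mp h2
      rw [fiberSum_of_pair hab h2, fiberSum_of_empty h1] at hs
      refine Or.inr (Or.inl ?_)
      rcases ha : N.sign a <;> rcases hb : N.sign b <;> simp [ha, hb, Sign.val] at hs
      · exact ⟨a, b, ha, hb, h1, h2⟩
      · exact ⟨b, a, hb, ha, h1, by rw [h2, Set.pair_comm]⟩
    · obtain ⟨a, h1⟩ := Set.ncard_eq_one.mp h1
      obtain ⟨b, h2⟩ := Set.ncard_eq_one.mp h2
      rw [fiberSum_of_single h1, fiberSum_of_single h2] at hs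
      refine Or.inr (Or.inr ?_)
      rcases ha : M.sign a <;> rcases hb : N.sign b <;> simp [ha, hb, Sign.val] at hs
      · exact Or.inl ⟨a, b, ha, hb, h1, h2⟩
      · exact Or.inr (Or.inl ⟨a, b, ha, hb, h1, h2⟩)

/-- An oriented one-dimensional cobordism: a finite set of connected components and the component
of every incoming and every outgoing boundary point, such that every component is an oriented
segment or a closed loop. -/
structure Curve (M N : OneCob.{u}) where
  comp : Type u
  [finite : Finite comp]
  lin : M.points → comp
  lout : N.points → comp
  oriented : ∀ c, OrientedAt M N lin lout c

namespace Curve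

attribute [instance] Curve.finite

variable {M N K L : OneCob.{u}}

/-- Two oriented one-dimensional cobordisms with the same boundary are identified if there is a
bijection between their sets of components that is compatible with the boundary points. -/
def Equivalent (φ ψ : Curve M N) : Prop :=
  ∃ χ : φ.comp ≃ ψ.comp, (∀ x, χ (φ.lin x) = ψ.lin x) ∧ (∀ y, χ (φ.lout y) = ψ.lout y)

theorem Equivalent.refl (φ : Curve M N) : φ.Equivalent φ :=
  ⟨Equiv.refl _, fun _ => rfl, fun _ => rfl⟩

theorem Equivalent.symm {φ ψ : Curve M N} : φ.Equivalent ψ → ψ.Equivalent φ := by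
  rintro ⟨χ, h1, h2⟩
  exact ⟨χ.symm, fun x => by rw [← h1, χ.symm_apply_apply],
    fun y => by rw [← h2, χ.symm_apply_apply]⟩

theorem Equivalent.trans {φ ψ θ : Curve M N} :
    φ.Equivalent ψ → ψ.Equivalent θ → φ.Equivalent θ := by
  rintro ⟨χ, h1, h2⟩ ⟨χ', h1', h2'⟩
  exact ⟨χ.trans χ', fun x => by simp [h1, h1'], fun y => by simp [h2, h2']⟩

instance setoid (M N : OneCob.{u}) : Setoid (Curve M N) where
  r := Equivalent
  iseqv := ⟨Equivalent.refl, Equivalent.symm, Equivalent.trans⟩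

open Classical in
/-- The surface cobordism obtained by taking the product of a curve with a circle: points become circles,
segments become cylinders (genus zero), and closed loops become tori (genus one). -/
noncomputable abbrev toSurface (φ : Curve M N) : Surface M.points N.points where
  comp := φ.comp
  lin := φ.lin
  lout := φ.lout
  genus c := if c ∈ Set.range φ.lin ∪ Set.range φ.lout then 0 else 1

theorem two_mul_excess (φ : Curve M N) (c : φ.comp) :
    2 * φ.toSurface.excess c = -(fiberSum φ.lin 1 c + fiberSum φ.lout 1 c) := by
  classical
  have h0 : c ∉ Set.range φ.lin ∪ Set.range φ.lout ↔
      fiberSum φ.lin 1 c + fiberSum φ.lout 1 c = 0 := by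
    have e1 := fiberSum_one φ.lin c
    have e2 := fiberSum_one φ.lout c
    rw [e1, e2]
    have : ((φ.lin ⁻¹' {c}).ncard : ℤ) + ((φ.lout ⁻¹' {c}).ncard : ℤ) = 0 ↔
      (φ.lin ⁻¹' {c}).ncard = 0 ∧ (φ.lout ⁻¹' {c}).ncard = 0 := by omega
    rw [this, Set.ncard_eq_zero, Set.ncard_eq_zero, Set.preimage_singleton_eq_empty,
      Set.preimage_singleton_eq_empty, Set.mem_union, not_or]
  have h := ((orientedAt_iff _ _ _ _ c).mp (φ.oriented c)).1
  by_cases hc : c ∈ Set.range φ.lin ∪ Set.range φ.lout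
  · have h2 := h.resolve_left (fun h' => h0.mpr h' hc)
    rw [h2]
    simp [Surface.excess, hc]
  · rw [h0.mp hc]
    simp [Surface.excess, hc]

/-- The identity cobordism. -/
abbrev id (M : OneCob.{u}) : Curve M M where
  comp := M.points
  lin := _root_.id
  lout := _root_.id
  oriented c := by
    rcases h : M.sign c
    · exact Or.inr (Or.inr (Or.inl ⟨c, c, h, h, rfl, rfl⟩))
    · exact Or.inr (Or.inr (Or.inr (Or.inl ⟨c, c, h, h, rfl, rfl⟩)))

theorem two_mul_excess_trans (φ : Curve M K) (ψ : Curve K N) (x : Glue φ.lout ψ.lin) :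
    2 * (φ.toSurface.trans ψ.toSurface).excess x
      = -(fiberSum (fun a => Glue.inl φ.lout ψ.lin (φ.lin a)) 1 x
        + fiberSum (fun b => Glue.inr φ.lout ψ.lin (ψ.lout b)) 1 x) := by
  have hA : (2 : ℤ) • φ.toSurface.excess = (-1 : ℤ) • (fiberSum φ.lin 1 + fiberSum φ.lout 1) := by
    funext c
    have := φ.two_mul_excess c
    simp only [Pi.smul_apply, Pi.add_apply, smul_eq_mul]
    linarith
  have hB : (2 : ℤ) • ψ.toSurface.excess = (-1 : ℤ) • (fiberSum ψ.lin 1 + fiberSum ψ.lout 1) := by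
    funext c
    have := ψ.two_mul_excess c
    simp only [Pi.smul_apply, Pi.add_apply, smul_eq_mul]
    linarith
  have hA' := congrFun (congrArg (fiberSum (Glue.inl φ.lout ψ.lin)) hA) x
  have hB' := congrFun (congrArg (fiberSum (Glue.inr φ.lout ψ.lin)) hB) x
  rw [fiberSum_smul, fiberSum_smul, fiberSum_add, fiberSum_comp, fiberSum_comp] at hA' hB'
  have hk : Glue.inr φ.lout ψ.lin ∘ ψ.lin = Glue.inl φ.lout ψ.lin ∘ φ.lout :=
    funext fun z => (Glue.condition φ.lout ψ.lin z).symm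
  rw [hk] at hB'
  simp only [Pi.smul_apply, Pi.add_apply, smul_eq_mul] at hA' hB'
  rw [Surface.excess_trans]
  simp only [Pi.add_apply]
  have e1 : (fun a => Glue.inl φ.lout ψ.lin (φ.lin a)) = Glue.inl φ.lout ψ.lin ∘ φ.lin := rfl
  have e2 : (fun b => Glue.inr φ.lout ψ.lin (ψ.lout b)) = Glue.inr φ.lout ψ.lin ∘ ψ.lout := rfl
  rw [e1, e2]
  linarith

theorem signSum_trans (φ : Curve M K) (ψ : Curve K N) :
    M.signSum (fun a => Glue.inl φ.lout ψ.lin (φ.lin a))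
      = N.signSum (fun b => Glue.inr φ.lout ψ.lin (ψ.lout b)) := by
  have hA : M.signSum φ.lin = K.signSum φ.lout :=
    funext fun c => ((orientedAt_iff _ _ _ _ c).mp (φ.oriented c)).2
  have hB : K.signSum ψ.lin = N.signSum ψ.lout :=
    funext fun c => ((orientedAt_iff _ _ _ _ c).mp (ψ.oriented c)).2
  have hA' := congrArg (fiberSum (Glue.inl φ.lout ψ.lin)) hA
  have hB' := congrArg (fiberSum (Glue.inr φ.lout ψ.lin)) hB
  unfold OneCob.signSum at hA' hB' ⊢
  rw [fiberSum_comp, fiberSum_comp] at hA' hB'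
  have hk : Glue.inr φ.lout ψ.lin ∘ ψ.lin = Glue.inl φ.lout ψ.lin ∘ φ.lout :=
    funext fun z => (Glue.condition φ.lout ψ.lin z).symm
  rw [hk] at hB'
  exact hA'.trans hB'

/-- Composition by gluing. -/
abbrev trans (φ : Curve M K) (ψ : Curve K N) : Curve M N where
  comp := Glue φ.lout ψ.lin
  lin x := Glue.inl _ _ (φ.lin x)
  lout y := Glue.inr _ _ (ψ.lout y)
  oriented x := by
    rw [orientedAt_iff]
    refine ⟨?_, congrFun (signSum_trans φ ψ) x⟩
    have h := two_mul_excess_trans φ ψ x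
    have h1 : (-1 : ℤ) ≤ (φ.toSurface.trans ψ.toSurface).excess x := by
      unfold Surface.excess; omega
    have e1 := fiberSum_one (fun a => Glue.inl φ.lout ψ.lin (φ.lin a)) x
    have e2 := fiberSum_one (fun b => Glue.inr φ.lout ψ.lin (ψ.lout b)) x
    omega

theorem trans_congr {φ φ' : Curve M K} {ψ ψ' : Curve K N} :
    φ.Equivalent φ' → ψ.Equivalent ψ' → (φ.trans ψ).Equivalent (φ'.trans ψ') := by
  rintro ⟨σ, h1, h2⟩ ⟨τ, h1', h2'⟩
  refine ⟨Glue.congr σ τ h2 h1', fun x => ?_, fun y => ?_⟩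
  · change Glue.inl _ _ (σ (φ.lin x)) = _
    rw [h1]
  · change Glue.inr _ _ (τ (ψ.lout y)) = _
    rw [h2']

theorem id_trans (φ : Curve M N) : ((Curve.id M).trans φ).Equivalent φ :=
  ⟨Glue.idLeft φ.lin, fun _ => rfl, fun _ => rfl⟩

theorem trans_id (φ : Curve M N) : (φ.trans (Curve.id N)).Equivalent φ :=
  ⟨Glue.idRight φ.lout, fun _ => rfl, fun _ => rfl⟩

theorem assoc (φ : Curve M K) (ψ : Curve K L) (θ : Curve L N) :
    ((φ.trans ψ).trans θ).Equivalent (φ.trans (ψ.trans θ)) :=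
  ⟨Glue.assoc φ.lout ψ.lin ψ.lout θ.lin, fun _ => rfl, fun _ => rfl⟩

/-- No creation: distinct outgoing points lie on distinct components. -/
def NoCreation (φ : Curve M N) : Prop := Function.Injective φ.lout

/-- No annihilation: distinct incoming points lie on distinct components. -/
def NoAnnihilation (φ : Curve M N) : Prop := Function.Injective φ.lin

/-- No closed loops: every component has a boundary point. -/
def NoLoops (φ : Curve M N) : Prop := ∀ c, c ∈ Set.range φ.lin ∪ Set.range φ.lout

theorem NoCreation.congr {φ ψ : Curve M N} (h : φ.Equivalent ψ) (hφ : φ.NoCreation) :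
    ψ.NoCreation := by
  obtain ⟨χ, h1, h2⟩ := h
  exact fun x y hxy => hφ (χ.injective (by rw [h2, h2, hxy]))

theorem NoAnnihilation.congr {φ ψ : Curve M N} (h : φ.Equivalent ψ) (hφ : φ.NoAnnihilation) :
    ψ.NoAnnihilation := by
  obtain ⟨χ, h1, h2⟩ := h
  exact fun x y hxy => hφ (χ.injective (by rw [h1, h1, hxy]))

theorem mem_range_congr {φ ψ : Curve M N} (χ : φ.comp ≃ ψ.comp)
    (h1 : ∀ x, χ (φ.lin x) = ψ.lin x) (h2 : ∀ y, χ (φ.lout y) = ψ.lout y) (c : φ.comp) :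
    χ c ∈ Set.range ψ.lin ∪ Set.range ψ.lout ↔ c ∈ Set.range φ.lin ∪ Set.range φ.lout := by
  simp only [Set.mem_union, Set.mem_range, ← h1, ← h2, χ.apply_eq_iff_eq]

theorem NoLoops.congr {φ ψ : Curve M N} (h : φ.Equivalent ψ) (hφ : φ.NoLoops) : ψ.NoLoops := by
  obtain ⟨χ, h1, h2⟩ := h
  intro c
  obtain ⟨c, rfl⟩ := χ.surjective c
  exact (mem_range_congr χ h1 h2 c).mpr (hφ c)

theorem toSurface_congr {φ ψ : Curve M N} (h : φ.Equivalent ψ) :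
    φ.toSurface.Equivalent ψ.toSurface := by
  obtain ⟨χ, h1, h2⟩ := h
  classical
  refine ⟨χ, h1, h2, fun c => ?_⟩
  exact if_congr (mem_range_congr χ h1 h2 c) rfl rfl

theorem toSurface_id (M : OneCob.{u}) :
    (Curve.id M).toSurface.Equivalent (Surface.id M.points) :=
  ⟨Equiv.refl _, fun _ => rfl, fun _ => rfl, fun c => by simp⟩

theorem toSurface_trans (φ : Curve M K) (ψ : Curve K N) :
    (φ.trans ψ).toSurface.Equivalent (φ.toSurface.trans ψ.toSurface) := by
  refine Surface.equivalent_of_excess (Equiv.refl _) (fun _ => rfl) (fun _ => rfl) fun c => ?_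
  have h1 := two_mul_excess_trans φ ψ c
  have h2 := (φ.trans ψ).two_mul_excess c
  change (φ.toSurface.trans ψ.toSurface).excess c = _
  linarith

end Curve

namespace OneCob

/-- Morphisms are oriented one-dimensional cobordisms up to equivalence relative to the boundary
points; composition is gluing. -/
instance : Category.{u + 1} OneCob.{u} where
  Hom M N := Quotient (Curve.setoid M N)
  id M := ⟦Curve.id M⟧
  comp f g := Quotient.map₂ Curve.trans (fun _ _ h _ _ h' => Curve.trans_congr h h') f g
  id_comp f := by
    induction f using Quotient.inductionOn with
    | h φ => exact Quotient.sound (Curve.id_trans φ)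
  comp_id f := by
    induction f using Quotient.inductionOn with
    | h φ => exact Quotient.sound (Curve.trans_id φ)
  assoc f g h := by
    induction f using Quotient.inductionOn with
    | h φ => induction g using Quotient.inductionOn with
      | h ψ => induction h using Quotient.inductionOn with
        | h θ => exact Quotient.sound (Curve.assoc φ ψ θ)

/-- The class of cofibrations: cobordisms with no creation. -/
def cofibrations : MorphismProperty OneCob.{u} := fun M N f =>
  Quotient.lift (s := Curve.setoid M N) Curve.NoCreation
    (fun _ _ h => propext ⟨Curve.NoCreation.congr h,
      Curve.NoCreation.congr (Curve.Equivalent.symm h)⟩) f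

/-- The class of fibrations: cobordisms with no annihilation and no closed loops. -/
def fibrations : MorphismProperty OneCob.{u} := fun M N f =>
  Quotient.lift (s := Curve.setoid M N) (fun φ => φ.NoAnnihilation ∧ φ.NoLoops)
    (fun _ _ h => propext ⟨fun h' => ⟨h'.1.congr h, h'.2.congr h⟩,
      fun h' => ⟨h'.1.congr h.symm, h'.2.congr h.symm⟩⟩) f

end OneCob

/-- The functor from oriented one-dimensional cobordisms to two-dimensional cobordisms that sends
every point to a circle, every segment to a cylinder and every closed loop to a torus. The genus of
a loop is forced by functoriality: gluing two segments to a loop corresponds to gluing two cylinders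
along both of their boundary circles. -/
noncomputable def Φ : OneCob.{u} ⥤ TwoCob.{u} where
  obj M := { circles := M.points }
  map {M N} f := Quotient.map (sa := Curve.setoid M N)
    (sb := Surface.setoid M.points N.points) Curve.toSurface
    (fun _ _ h => Curve.toSurface_congr h) f
  map_id M := Quotient.sound (Curve.toSurface_id M)
  map_comp f g := by
    induction f using Quotient.inductionOn with
    | h φ => induction g using Quotient.inductionOn with
      | h ψ => exact Quotient.sound (Curve.toSurface_trans φ ψ)

end Cob

/-! A cobordism from `m` to `n` is cut along one circle for each component that meets both ends. The
components that meet `m`, together with the closed ones, keep their genus and form the cofibration.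
The components that meet `n` form the fibration, with genus moved to the left wherever a component
also meets `m`. This is `Surface.exists_factorization`.

Two features of a fibration drive the rest. Since its incoming boundary is injective and lies on
components of genus zero, gluing it on neither merges components of the left factor nor changes
their genus. Since its outgoing boundary is surjective, an equivalence of composites is determined
on its components. Hence a fibration can be cancelled on the right (`Surface.IsFibration.cancel`),
which gives uniqueness of fillers. For existence (`Surface.exists_lift`), both `π` and `ρ` in a
square `π ≫ μ = ε ≫ ρ` embed in the common composite, and the filler consists of the components they
share.

For curves, `2 * (genus - 1)` is minus the number of boundary points of a component, so the genus
carries no extra information and `Φ` is faithful. `Φ` is not full, but a left factor of some `Φ.map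
f` whose right factor is the image of a fibration does lie in the image
(`Curve.exists_toSurface_equivalent`): segments of the fibration carry each middle point to one
outgoing point of the same sign, so the counts defining a curve can be read off from `f`. Fillers
therefore descend along `Φ`, and uniqueness of factorizations in `TwoCob` yields the last claim. -/

namespace Cob

/-! ### Fibre sums along injective maps -/

section fiberSum

variable {α β γ : Type*}

theorem fiberSum_comp_injective {h : β → γ} (hh : Function.Injective h) (f : α → β) (e : α → ℤ)
    (x : β) : fiberSum (h ∘ f) e (h x) = fiberSum f e x := by
  have h' : h ∘ f ⁻¹' {h x} = f ⁻¹' {x} := by ext a; simp [hh.eq_iff]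
  unfold fiberSum
  rw [h']

theorem fiberSum_injective {f : α → β} (hf : Function.Injective f) (e : α → ℤ) (a : α) :
    fiberSum f e (f a) = e a :=
  fiberSum_of_single (by ext b; simp [hf.eq_iff]) e

theorem fiberSum_zero (f : α → β) (x : β) : fiberSum f (fun _ => 0) x = 0 := by
  simp [fiberSum]

theorem fiberSum_nonneg (f : α → β) {e : α → ℤ} (he : ∀ a, 0 ≤ e a) (x : β) :
    0 ≤ fiberSum f e x :=
  finsum_nonneg fun a => finsum_nonneg fun _ => he a

end fiberSum

/-! ### Equality and fibres in a pushout of sets -/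

namespace Glue

variable {k A B : Type u} {f : k → A} {g : k → B}

theorem exists_rep (x : Glue f g) : (∃ a, x = inl f g a) ∨ ∃ b, x = inr f g b :=
  ind (P := fun x => (∃ a, x = inl f g a) ∨ ∃ b, x = inr f g b)
    (fun a => Or.inl ⟨a, rfl⟩) (fun b => Or.inr ⟨b, rfl⟩) x

/-- Equality in the quotient is tested by a predicate `P` that describes the class of `inl f g a'`
on both summands. Injectivity of `g` makes `P` respect the gluing, and transporting `P` along the
equality gives the claim. The lemmas below vary `P`. -/
theorem inl_eq_inl_iff (hg : Function.Injective g) {a a' : A} :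
    inl f g a = inl f g a' ↔ a = a' := by
  refine ⟨fun h => ?_, fun h => h ▸ rfl⟩
  let P : Glue f g → Prop := desc (· = a') (fun b => ∃ z, g z = b ∧ f z = a')
    (fun z => propext ⟨fun h => ⟨z, rfl, h⟩, by rintro ⟨z', h, h'⟩; rwa [← hg h]⟩)
  exact (congrArg P h).mpr rfl

theorem inl_eq_inr_iff (hg : Function.Injective g) {a : A} {b : B} :
    inl f g a = inr f g b ↔ ∃ z, f z = a ∧ g z = b := by
  constructor
  · intro h
    let P : Glue f g → Prop := desc (· = a) (fun b => ∃ z, f z = a ∧ g z = b)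
      (fun z => propext ⟨fun h => ⟨z, h, rfl⟩, by rintro ⟨z', h, h'⟩; rwa [← hg h']⟩)
    exact (congrArg P h).mp rfl
  · rintro ⟨z, rfl, rfl⟩
    exact condition f g z

theorem inr_eq_inr_iff (hf : Function.Injective f) {b b' : B} :
    inr f g b = inr f g b' ↔ b = b' := by
  refine ⟨fun h => ?_, fun h => h ▸ rfl⟩
  let P : Glue f g → Prop := desc (fun a => ∃ z, f z = a ∧ g z = b') (· = b')
    (fun z => propext ⟨by rintro ⟨z', h, h'⟩; rwa [← hf h], fun h => ⟨z, rfl, h⟩⟩)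
  exact (congrArg P h).mpr rfl

theorem mem_range_right {a : A} {b : B} (h : inl f g a = inr f g b) : b ∈ Set.range g := by
  let P : Glue f g → Prop := desc (fun _ => True) (· ∈ Set.range g) (fun z => by simp)
  exact (congrArg P h).mp trivial

theorem mem_range_left {a : A} {b : B} (h : inl f g a = inr f g b) : a ∈ Set.range f := by
  let P : Glue f g → Prop := desc (· ∈ Set.range f) (fun _ => True) (fun z => by simp)
  exact (congrArg P h).mpr trivial

/-- A point outside the range of the gluing map is alone in its class, whether or not the maps are
injective. -/
theorem eq_of_inr_eq {b b' : B} (hb : b ∉ Set.range g) (h : inr f g b = inr f g b') : b = b' := by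
  let P : Glue f g → Prop := desc (fun _ => False) (b = ·)
    (fun z => by simp only [eq_iff_iff, false_iff]; rintro rfl; exact hb ⟨z, rfl⟩)
  exact (congrArg P h).mp rfl

theorem eq_of_inl_eq {a a' : A} (ha : a ∉ Set.range f) (h : inl f g a = inl f g a') : a = a' := by
  let P : Glue f g → Prop := desc (a = ·) (fun _ => False)
    (fun z => by simp only [eq_iff_iff, iff_false]; rintro rfl; exact ha ⟨z, rfl⟩)
  exact (congrArg P h).mp rfl

/-- When `g` is injective, `g` maps the fibre of `f` over `a` bijectively onto the points of `B`
glued to `a`, so the sum can be taken over `k`. -/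
theorem fiberSum_inr_inl (hg : Function.Injective g) (e : B → ℤ) (a : A) :
    fiberSum (inr f g) e (inl f g a) = fiberSum f (fun z => e (g z)) a := by
  have h : inr f g ⁻¹' {inl f g a} = g '' (f ⁻¹' {a}) := by
    ext b
    simp only [Set.mem_preimage, Set.mem_singleton_iff, Set.mem_image]
    rw [eq_comm, inl_eq_inr_iff hg]
  unfold fiberSum
  rw [h, finsum_mem_image hg.injOn]

theorem fiberSum_inl_inr (hf : Function.Injective f) (e : A → ℤ) (b : B) :
    fiberSum (inl f g) e (inr f g b) = fiberSum g (fun z => e (f z)) b := by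
  have h : inl f g ⁻¹' {inr f g b} = f '' (g ⁻¹' {b}) := by
    ext a
    simp only [Set.mem_preimage, Set.mem_singleton_iff, Set.mem_image]
    constructor
    · intro h
      obtain ⟨z, rfl⟩ := mem_range_left h
      rw [condition, inr_eq_inr_iff hf] at h
      exact ⟨z, h, rfl⟩
    · rintro ⟨z, rfl, rfl⟩
      exact condition f g z
  unfold fiberSum
  rw [h, finsum_mem_image hf.injOn]

/-- A set covered by two subsets is the pushout of these subsets along their intersection. -/
noncomputable def subtypeEquiv {C : Type u} {p q : C → Prop} (h : ∀ c, p c ∨ q c) :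
    Glue (fun z : {c // p c ∧ q c} => (⟨z.1, z.2.1⟩ : {c // p c}))
      (fun z : {c // p c ∧ q c} => (⟨z.1, z.2.2⟩ : {c // q c})) ≃ C :=
  Equiv.ofBijective (desc Subtype.val Subtype.val fun _ => rfl) <| by
    constructor
    · refine ind (fun a => ind (fun a' haa => ?_) (fun b hab => ?_))
        (fun b => ind (fun a hab => ?_) (fun b' hbb => ?_))
      · exact congrArg _ (Subtype.ext haa)
      · obtain ⟨c, hc⟩ := a
        obtain ⟨c', hc'⟩ := b
        obtain rfl : c = c' := hab
        exact condition _ _ (⟨c, hc, hc'⟩ : {c // p c ∧ q c})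
      · obtain ⟨c, hc⟩ := a
        obtain ⟨c', hc'⟩ := b
        obtain rfl : c' = c := hab
        exact (condition _ _ (⟨c', hc, hc'⟩ : {c // p c ∧ q c})).symm
      · exact congrArg _ (Subtype.ext hbb)
    · intro c
      rcases h c with hc | hc
      · exact ⟨inl _ _ ⟨c, hc⟩, rfl⟩
      · exact ⟨inr _ _ ⟨c, hc⟩, rfl⟩

end Glue

/-! ### Surface cobordisms: genus of composites, factorization, cancellation, fillers -/

namespace Surface

variable {m n k l : Type u}

theorem genus_trans [Finite k] (φ : Surface m k) (ψ : Surface k n) (x : GlueComp φ ψ) :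
    ((φ.trans ψ).genus x : ℤ) = 1 + fiberSum (Glue.inl φ.lout ψ.lin) φ.excess x
      + fiberSum (Glue.inr φ.lout ψ.lin) ψ.excess x
      + fiberSum (Glue.inl φ.lout ψ.lin ∘ φ.lout) 1 x := by
  have h := congrFun (excess_trans φ ψ) x
  simp only [Pi.add_apply] at h
  change ((φ.trans ψ).genus x : ℤ) - 1 = _ at h
  linarith

/-- The `1` contributed by a gluing circle cancels the `-1` in the excess of the component attached
there. -/
theorem fiberSum_excess_add_one [Finite k] {φ : Surface m n} (f : k → l) (g : k → φ.comp) (x : l) :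
    fiberSum f (fun z => φ.excess (g z)) x + fiberSum f 1 x
      = fiberSum f (fun z => (φ.genus (g z) : ℤ)) x := by
  rw [← Pi.add_apply, ← fiberSum_add]
  congr 1
  funext z
  simp [excess]

/-- Each component of `ψ` glued to `a` is attached along exactly one circle, so the gluing graph is
a star without cycles and genera simply add. -/
theorem genus_trans_inl [Finite k] (φ : Surface m k) {ψ : Surface k n}
    (h : Function.Injective ψ.lin) (a : φ.comp) :
    ((φ.trans ψ).genus (Glue.inl φ.lout ψ.lin a) : ℤ)
      = φ.genus a + fiberSum φ.lout (fun z => (ψ.genus (ψ.lin z) : ℤ)) a := by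
  have hi : Function.Injective (Glue.inl φ.lout ψ.lin) := fun a a' => (Glue.inl_eq_inl_iff h).mp
  rw [genus_trans, fiberSum_injective hi, Glue.fiberSum_inr_inl h, fiberSum_comp_injective hi,
    ← fiberSum_excess_add_one]
  simp only [excess]
  ring

theorem genus_trans_inr [Finite k] {φ : Surface m k} (ψ : Surface k n)
    (h : Function.Injective φ.lout) (b : ψ.comp) :
    ((φ.trans ψ).genus (Glue.inr φ.lout ψ.lin b) : ℤ)
      = ψ.genus b + fiberSum ψ.lin (fun z => (φ.genus (φ.lout z) : ℤ)) b := by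
  have hi : Function.Injective (Glue.inr φ.lout ψ.lin) := fun a a' => (Glue.inr_eq_inr_iff h).mp
  have hc : Glue.inl φ.lout ψ.lin ∘ φ.lout = Glue.inr φ.lout ψ.lin ∘ ψ.lin :=
    funext fun z => Glue.condition φ.lout ψ.lin z
  rw [genus_trans, fiberSum_injective hi, Glue.fiberSum_inl_inr h, hc, fiberSum_comp_injective hi,
    ← fiberSum_excess_add_one]
  simp only [excess]
  ring

theorem genus_trans_inr_of_notMem [Finite k] (φ : Surface m k) (ψ : Surface k n) {b : ψ.comp}
    (hb : b ∉ Set.range ψ.lin) : (φ.trans ψ).genus (Glue.inr φ.lout ψ.lin b) = ψ.genus b := by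
  have h1 : fiberSum (Glue.inl φ.lout ψ.lin) φ.excess (Glue.inr φ.lout ψ.lin b) = 0 :=
    fiberSum_of_empty (Set.eq_empty_of_forall_notMem fun a ha => hb (Glue.mem_range_right ha)) _
  have h2 : fiberSum (Glue.inr φ.lout ψ.lin) ψ.excess (Glue.inr φ.lout ψ.lin b) = ψ.excess b :=
    fiberSum_of_single (Set.eq_singleton_iff_unique_mem.mpr
      ⟨rfl, fun b' h => (Glue.eq_of_inr_eq (b' := b') hb (Eq.symm h)).symm⟩) _
  have h3 : fiberSum (Glue.inl φ.lout ψ.lin ∘ φ.lout) 1 (Glue.inr φ.lout ψ.lin b) = 0 :=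
    fiberSum_of_empty (Set.eq_empty_of_forall_notMem fun z hz => hb (Glue.mem_range_right hz)) _
  have h := genus_trans φ ψ (Glue.inr φ.lout ψ.lin b)
  rw [h1, h2, h3] at h
  unfold excess at h
  omega

theorem genus_trans_inl_of_notMem [Finite k] (φ : Surface m k) (ψ : Surface k n) {a : φ.comp}
    (ha : a ∉ Set.range φ.lout) : (φ.trans ψ).genus (Glue.inl φ.lout ψ.lin a) = φ.genus a := by
  have h1 : fiberSum (Glue.inr φ.lout ψ.lin) ψ.excess (Glue.inl φ.lout ψ.lin a) = 0 :=
    fiberSum_of_empty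
      (Set.eq_empty_of_forall_notMem fun b hb => ha (Glue.mem_range_left (Eq.symm hb))) _
  have h2 : fiberSum (Glue.inl φ.lout ψ.lin) φ.excess (Glue.inl φ.lout ψ.lin a) = φ.excess a :=
    fiberSum_of_single (Set.eq_singleton_iff_unique_mem.mpr
      ⟨rfl, fun a' h => (Glue.eq_of_inl_eq (a' := a') ha (Eq.symm h)).symm⟩) _
  have h3 : fiberSum (Glue.inl φ.lout ψ.lin ∘ φ.lout) 1 (Glue.inl φ.lout ψ.lin a) = 0 :=
    fiberSum_of_empty (Set.eq_empty_of_forall_notMem fun z hz =>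
      ha ⟨z, (Glue.eq_of_inl_eq ha (Eq.symm hz)).symm⟩) _
  have h := genus_trans φ ψ (Glue.inl φ.lout ψ.lin a)
  rw [h1, h2, h3] at h
  unfold excess at h
  omega

/-- Gluing on a fibration does not change the genus of the components that are glued. -/
theorem IsFibration.genus_trans_inl [Finite k] (φ : Surface m k) {ψ : Surface k n}
    (h : ψ.IsFibration) (a : φ.comp) :
    (φ.trans ψ).genus (Glue.inl φ.lout ψ.lin a) = φ.genus a := by
  have h1 := Surface.genus_trans_inl φ h.1 a
  simp only [h.2.2, Nat.cast_zero, fiberSum_zero, add_zero] at h1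
  exact_mod_cast h1

/-- An outgoing circle is traced back through `ψ` to the middle circle `w y`, and from there through
`φ` to the incoming circle `v (w y)`. -/
theorem IsCofibration.trans [Finite k] {φ : Surface m k} {ψ : Surface k n} (hφ : φ.IsCofibration)
    (hψ : ψ.IsCofibration) : (φ.trans ψ).IsCofibration := by
  obtain ⟨hi, v, hv⟩ := hφ
  obtain ⟨hi', w, hw⟩ := hψ
  refine ⟨fun x y h => hi' ((Glue.inr_eq_inr_iff hi).mp h), v ∘ w, funext fun y => ?_⟩
  change Glue.inr _ _ (ψ.lout y) = Glue.inl _ _ (φ.lin (v (w y)))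
  rw [hw, ← Function.comp_apply (f := φ.lin), ← hv]
  exact (Glue.condition _ _ _).symm

theorem IsFibration.trans [Finite k] {φ : Surface m k} {ψ : Surface k n} (hφ : φ.IsFibration)
    (hψ : ψ.IsFibration) : (φ.trans ψ).IsFibration := by
  refine ⟨fun x y h => hφ.1 ((Glue.inl_eq_inl_iff hψ.1).mp h), ?_, fun x => ?_⟩
  · have hr : ∀ b, ∃ y, (φ.trans ψ).lout y = Glue.inr φ.lout ψ.lin b := fun b => by
      obtain ⟨y, rfl⟩ := hψ.2.1 b
      exact ⟨y, rfl⟩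
    refine Glue.ind (fun a => ?_) hr
    obtain ⟨z, rfl⟩ := hφ.2.1 a
    rw [Glue.condition]
    exact hr _
  · exact (hψ.genus_trans_inl φ _).trans (hφ.2.2 x)

/-- The components of an invertible cobordism are cylinders. -/
theorem bijective_of_inverse [Finite m] [Finite n] {φ : Surface m n} {ψ : Surface n m}
    (h : (φ.trans ψ).Equivalent (Surface.id m)) (h' : (ψ.trans φ).Equivalent (Surface.id n)) :
    Function.Bijective φ.lin ∧ Function.Bijective φ.lout ∧ ∀ c, φ.genus c = 0 := by
  obtain ⟨χ, h1, h2, h3⟩ := h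
  obtain ⟨χ', h1', h2', h3'⟩ := h'
  -- The boundary maps of an identity are injective and factor through those of `φ` and `ψ`.
  have i1 : Function.Injective φ.lin := fun x y hxy => by
    have := (h1 x).symm.trans ((congrArg (fun a => χ (Glue.inl _ _ a)) hxy).trans (h1 y))
    exact this
  have i2 : Function.Injective ψ.lout := fun x y hxy => by
    have := (h2 x).symm.trans ((congrArg (fun a => χ (Glue.inr _ _ a)) hxy).trans (h2 y))
    exact this
  have i3 : Function.Injective ψ.lin := fun x y hxy => by
    have := (h1' x).symm.trans ((congrArg (fun a => χ' (Glue.inl _ _ a)) hxy).trans (h1' y))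
    exact this
  have i4 : Function.Injective φ.lout := fun x y hxy => by
    have := (h2' x).symm.trans ((congrArg (fun a => χ' (Glue.inr _ _ a)) hxy).trans (h2' y))
    exact this
  refine ⟨⟨i1, fun a => ⟨χ (Glue.inl _ _ a), ?_⟩⟩, ⟨i4, fun a => ⟨χ' (Glue.inr _ _ a), ?_⟩⟩, ?_⟩
  -- Every component of the composite is a cylinder and so meets the incoming boundary; since `inl`
  -- is injective, this already holds in `φ`.
  · exact (Glue.inl_eq_inl_iff i3).mp (χ.injective (h1 _))
  · exact (Glue.inr_eq_inr_iff i2).mp (χ'.injective (h2' _))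
  · intro c
    -- The genus `0` of the cylinder is `φ.genus c` plus a nonnegative sum.
    have e1 := genus_trans_inl φ i3 c
    have e2 := fiberSum_nonneg φ.lout (e := fun z => (ψ.genus (ψ.lin z) : ℤ))
      (fun z => Int.natCast_nonneg _) c
    have e3 : 0 = (φ.trans ψ).genus (Glue.inl _ _ c) := h3 _
    omega

/-- Every cobordism is a cofibration followed by a fibration. -/
theorem exists_factorization (θ : Surface m n) :
    ∃ (k : Type u) (_ : Finite k) (φ : Surface m k) (ψ : Surface k n),
      φ.IsCofibration ∧ ψ.IsFibration ∧ (φ.trans ψ).Equivalent θ := by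
  classical
  -- Closed components must go to the left, as surjectivity of `lout` excludes them from a
  -- fibration.
  let p : θ.comp → Prop := fun c => c ∈ Set.range θ.lin ∨ c ∉ Set.range θ.lout
  let q : θ.comp → Prop := fun c => c ∈ Set.range θ.lout
  have hpq : ∀ c, p c ∨ q c := fun c => by simp only [p, q]; tauto
  have hin : ∀ z : {c // p c ∧ q c}, z.1 ∈ Set.range θ.lin := fun z =>
    z.2.1.resolve_right (not_not.mpr z.2.2)
  let φ : Surface m {c // p c ∧ q c} :=
    { comp := {c // p c}
      lin := fun x => ⟨θ.lin x, Or.inl ⟨x, rfl⟩⟩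
      lout := fun z => ⟨z.1, z.2.1⟩
      genus := fun c => θ.genus c.1 }
  let ψ : Surface {c // p c ∧ q c} n :=
    { comp := {c // q c}
      lin := fun z => ⟨z.1, z.2.2⟩
      lout := fun y => ⟨θ.lout y, y, rfl⟩
      -- A component on both sides leaves its whole genus to `φ`.
      genus := fun c => if c.1 ∈ Set.range θ.lin then 0 else θ.genus c.1 }
  have hψ : ψ.IsFibration := ⟨fun x y h => Subtype.ext (congrArg (fun c : {c // q c} => c.1) h),
    fun ⟨c, y, hy⟩ => ⟨y, Subtype.ext hy⟩, fun z => if_pos (hin z)⟩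
  refine ⟨_, inferInstance, φ, ψ, ⟨fun x y h => Subtype.ext (congrArg (fun c : {c // p c} => c.1) h),
    fun z => (hin z).choose, funext fun z => Subtype.ext (hin z).choose_spec.symm⟩, hψ,
    Glue.subtypeEquiv hpq, fun _ => rfl, fun _ => rfl, Glue.ind (fun a => ?_) (fun b => ?_)⟩
  · exact (hψ.genus_trans_inl φ a).symm
  · by_cases hb : b ∈ Set.range ψ.lin
    · obtain ⟨z, rfl⟩ := hb
      exact (hψ.genus_trans_inl φ (φ.lout z)).symm.trans
        (congrArg (φ.trans ψ).genus (Glue.condition φ.lout ψ.lin z))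
    · rw [genus_trans_inr_of_notMem φ ψ hb]
      refine (if_neg fun h => hb ⟨⟨b.1, Or.inl h, b.2⟩, rfl⟩).symm

/-- Gluing on a fibration is injective on equivalence classes of cobordisms. -/
theorem IsFibration.cancel [Finite k] {φ φ' : Surface m k} {ψ : Surface k n} (hψ : ψ.IsFibration)
    (h : (φ.trans ψ).Equivalent (φ'.trans ψ)) : φ.Equivalent φ' := by
  -- Each component of `ψ` has an outgoing circle, so `χ` is forced on `inr`. A component `inl a`
  -- sent to some `inr b` must then equal `inr b`, so `b` is glued and its image is also an `inl`.
  -- The statement is general in `φ` and `φ'` so that it applies to `χ.symm` too.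
  have key : ∀ {φ φ' : Surface m k} (χ : (φ.trans ψ).comp ≃ (φ'.trans ψ).comp),
      (∀ y, χ ((φ.trans ψ).lout y) = (φ'.trans ψ).lout y) →
      (∀ a, ∃ a', χ (Glue.inl φ.lout ψ.lin a) = Glue.inl φ'.lout ψ.lin a') ∧
      (∀ b, χ (Glue.inr φ.lout ψ.lin b) = Glue.inr φ'.lout ψ.lin b) := by
    intro φ φ' χ h2
    have hr : ∀ b, χ (Glue.inr φ.lout ψ.lin b) = Glue.inr φ'.lout ψ.lin b := fun b => by
      obtain ⟨y, rfl⟩ := hψ.2.1 b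
      exact h2 y
    refine ⟨fun a => ?_, hr⟩
    rcases Glue.exists_rep (χ (Glue.inl φ.lout ψ.lin a)) with ⟨a', ha⟩ | ⟨b, hx⟩
    · exact ⟨a', ha⟩
    · rw [← hr b] at hx
      obtain ⟨z, rfl⟩ := Glue.mem_range_right (χ.injective hx)
      exact ⟨_, hx.trans ((hr _).trans (Glue.condition _ _ z).symm)⟩
  obtain ⟨χ, h1, h2, h3⟩ := h
  obtain ⟨hl, hr⟩ := key χ h2
  obtain ⟨hl', -⟩ := key χ.symm fun y => by rw [← h2, χ.symm_apply_apply]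
  choose r hr' using hl
  have hbij : Function.Bijective r := by
    constructor
    · intro a b hab
      refine (Glue.inl_eq_inl_iff (f := φ.lout) hψ.1).mp (χ.injective ?_)
      rw [hr', hr', hab]
    · intro a'
      obtain ⟨a, ha⟩ := hl' a'
      refine ⟨a, (Glue.inl_eq_inl_iff (f := φ'.lout) hψ.1).mp ?_⟩
      rw [← hr', ← ha, χ.apply_symm_apply]
  refine ⟨Equiv.ofBijective r hbij, fun x => ?_, fun z => ?_, fun a => ?_⟩
  · exact (Glue.inl_eq_inl_iff (f := φ'.lout) hψ.1).mp ((hr' _).symm.trans (h1 x))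
  · refine (Glue.inl_eq_inl_iff (f := φ'.lout) hψ.1).mp ((hr' _).symm.trans ?_)
    rw [Glue.condition, Glue.condition, hr]
  · have e1 := h3 (Glue.inl _ _ a)
    rw [hr', hψ.genus_trans_inl, hψ.genus_trans_inl] at e1
    exact e1

/-- Recognition of a gluing along an injective incoming boundary. -/
theorem trans_equivalent_of_lin_injective [Finite k] {φ : Surface m k} {ψ : Surface k n}
    {θ : Surface m n} (hψ : Function.Injective ψ.lin) (σ : φ.comp → θ.comp) (τ : ψ.comp → θ.comp)
    (h : ∀ z, σ (φ.lout z) = τ (ψ.lin z)) (hσ : Function.Injective σ)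
    (hτ : ∀ b b', τ b = τ b' → b ∉ Set.range ψ.lin → b' ∉ Set.range ψ.lin → b = b')
    (hστ : ∀ a b, σ a = τ b → b ∈ Set.range ψ.lin)
    (hsurj : ∀ c, (∃ a, σ a = c) ∨ ∃ b, τ b = c)
    (hin : ∀ x, σ (φ.lin x) = θ.lin x) (hout : ∀ y, τ (ψ.lout y) = θ.lout y)
    (hl : ∀ a, (θ.genus (σ a) : ℤ)
      = φ.genus a + fiberSum φ.lout (fun z => (ψ.genus (ψ.lin z) : ℤ)) a)
    (hr : ∀ b, b ∉ Set.range ψ.lin → θ.genus (τ b) = ψ.genus b) : (φ.trans ψ).Equivalent θ := by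
  -- Normal form: glued components are represented on the left, so `τ` has to be injective only off
  -- the range of `ψ.lin`.
  have hrep : ∀ x : (φ.trans ψ).comp, (∃ a, x = Glue.inl φ.lout ψ.lin a) ∨
      ∃ b, b ∉ Set.range ψ.lin ∧ x = Glue.inr φ.lout ψ.lin b := fun x => by
    rcases Glue.exists_rep x with ⟨a, rfl⟩ | ⟨b, rfl⟩
    · exact Or.inl ⟨a, rfl⟩
    · by_cases hb : b ∈ Set.range ψ.lin
      · obtain ⟨z, rfl⟩ := hb
        exact Or.inl ⟨_, (Glue.condition _ _ z).symm⟩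
      · exact Or.inr ⟨b, hb, rfl⟩
  have hbij : Function.Bijective (Glue.desc σ τ h) := by
    constructor
    · intro x y hxy
      rcases hrep x with ⟨a, rfl⟩ | ⟨b, hb, rfl⟩ <;> rcases hrep y with ⟨a', rfl⟩ | ⟨b', hb', rfl⟩
      · exact congrArg _ (hσ hxy)
      · exact absurd (hστ a b' hxy) hb'
      · exact absurd (hστ a' b hxy.symm) hb
      · exact congrArg _ (hτ b b' hxy hb hb')
    · intro c
      rcases hsurj c with ⟨a, ha⟩ | ⟨b, hb⟩
      · exact ⟨Glue.inl _ _ a, ha⟩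
      · exact ⟨Glue.inr _ _ b, hb⟩
  refine ⟨Equiv.ofBijective _ hbij, hin, hout, fun x => ?_⟩
  rcases hrep x with ⟨a, rfl⟩ | ⟨b, hb, rfl⟩
  · exact_mod_cast (hl a).trans (genus_trans_inl φ hψ a).symm
  · exact (hr b hb).trans (genus_trans_inr_of_notMem φ ψ hb).symm

/-- Recognition of a gluing along an injective outgoing boundary. -/
theorem trans_equivalent_of_lout_injective [Finite k] {φ : Surface m k} {ψ : Surface k n}
    {θ : Surface m n} (hφ : Function.Injective φ.lout) (σ : φ.comp → θ.comp) (τ : ψ.comp → θ.comp)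
    (h : ∀ z, σ (φ.lout z) = τ (ψ.lin z)) (hτ : Function.Injective τ)
    (hσ : ∀ a a', σ a = σ a' → a ∉ Set.range φ.lout → a' ∉ Set.range φ.lout → a = a')
    (hστ : ∀ a b, σ a = τ b → a ∈ Set.range φ.lout)
    (hsurj : ∀ c, (∃ a, σ a = c) ∨ ∃ b, τ b = c)
    (hin : ∀ x, σ (φ.lin x) = θ.lin x) (hout : ∀ y, τ (ψ.lout y) = θ.lout y)
    (hr : ∀ b, (θ.genus (τ b) : ℤ)
      = ψ.genus b + fiberSum ψ.lin (fun z => (φ.genus (φ.lout z) : ℤ)) b)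
    (hl : ∀ a, a ∉ Set.range φ.lout → θ.genus (σ a) = φ.genus a) : (φ.trans ψ).Equivalent θ := by
  have hrep : ∀ x : (φ.trans ψ).comp, (∃ b, x = Glue.inr φ.lout ψ.lin b) ∨
      ∃ a, a ∉ Set.range φ.lout ∧ x = Glue.inl φ.lout ψ.lin a := fun x => by
    rcases Glue.exists_rep x with ⟨a, rfl⟩ | ⟨b, rfl⟩
    · by_cases ha : a ∈ Set.range φ.lout
      · obtain ⟨z, rfl⟩ := ha
        exact Or.inl ⟨_, Glue.condition _ _ z⟩
      · exact Or.inr ⟨a, ha, rfl⟩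
    · exact Or.inl ⟨b, rfl⟩
  have hbij : Function.Bijective (Glue.desc σ τ h) := by
    constructor
    · intro x y hxy
      rcases hrep x with ⟨b, rfl⟩ | ⟨a, ha, rfl⟩ <;> rcases hrep y with ⟨b', rfl⟩ | ⟨a', ha', rfl⟩
      · exact congrArg _ (hτ hxy)
      · exact absurd (hστ a' b hxy.symm) ha'
      · exact absurd (hστ a b' hxy) ha
      · exact congrArg _ (hσ a a' hxy ha ha')
    · intro c
      rcases hsurj c with ⟨a, ha⟩ | ⟨b, hb⟩
      · exact ⟨Glue.inl _ _ a, ha⟩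
      · exact ⟨Glue.inr _ _ b, hb⟩
  refine ⟨Equiv.ofBijective _ hbij, hin, hout, fun x => ?_⟩
  rcases hrep x with ⟨b, rfl⟩ | ⟨a, ha, rfl⟩
  · exact_mod_cast (hr b).trans (genus_trans_inr ψ hφ b).symm
  · exact (hl a ha).trans (genus_trans_inl_of_notMem φ ψ ha).symm

/-- Every square from a cofibration to a fibration has a diagonal filler, whose components are
the components that the two other sides have in common. -/
theorem exists_lift {x y x' y' : Type u} [Finite y] [Finite x'] {ε : Surface x y}
    {μ : Surface x' y'} {π : Surface x x'} {ρ : Surface y y'} (hε : ε.IsCofibration)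
    (hμ : μ.IsFibration) (h : (π.trans μ).Equivalent (ε.trans ρ)) :
    ∃ ω : Surface y x', (ε.trans ω).Equivalent π ∧ (ω.trans μ).Equivalent ρ := by
  obtain ⟨χ, h1, h2, h3⟩ := h
  obtain ⟨hε1, v, hv⟩ := hε
  have injl : ∀ {a a'}, Glue.inl π.lout μ.lin a = Glue.inl π.lout μ.lin a' → a = a' :=
    fun h => (Glue.inl_eq_inl_iff hμ.1).mp h
  have injr : ∀ {b b'}, Glue.inr ε.lout ρ.lin b = Glue.inr ε.lout ρ.lin b' → b = b' :=
    fun h => (Glue.inr_eq_inr_iff hε1).mp h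
  -- Components of `μ` are seen from the outgoing boundary, so they all lie in `ρ`.
  have hb : ∀ b, ∃ c, χ (Glue.inr _ _ b) = Glue.inr _ _ c := fun b => by
    obtain ⟨z, rfl⟩ := hμ.2.1 b
    exact ⟨_, h2 z⟩
  choose τ hτ using hb
  -- The component of `ρ` at the circle `z` is joined through `ε` to the incoming circle `v z`,
  -- hence also lies in `π`.
  have hy : ∀ z, χ (Glue.inl _ _ (π.lin (v z))) = Glue.inr _ _ (ρ.lin z) := fun z => by
    refine (h1 _).trans (Eq.trans ?_ (Glue.condition ε.lout ρ.lin z))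
    exact congrArg (Glue.inl ε.lout ρ.lin) (congrFun hv z).symm
  have hx' : ∀ z, χ (Glue.inl _ _ (π.lout z)) = Glue.inr _ _ (τ (μ.lin z)) := fun z => by
    rw [Glue.condition]
    exact hτ _
  let ω : Surface y x' :=
    { comp := {c : ρ.comp // ∃ p, χ (Glue.inl _ _ p) = Glue.inr _ _ c}
      lin := fun z => ⟨ρ.lin z, _, hy z⟩
      lout := fun z => ⟨τ (μ.lin z), _, hx' z⟩
      genus := fun c => ρ.genus c.1 }
  -- A component common to `π` and `μ` in the composite must be glued.
  have hmem : ∀ (w : ω.comp) b, w.1 = τ b → b ∈ Set.range μ.lin := by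
    rintro ⟨c, p, hp⟩ b rfl
    rw [← hτ] at hp
    exact Glue.mem_range_right (χ.injective hp)
  refine ⟨ω, ?_, ?_⟩
  -- Every component of `ε` lies in `π`: if it comes from `μ`, it also lies in `ρ`, so it has an
  -- outgoing circle of `ε` and `hy` applies.
  · have ha : ∀ a, ∃ p, χ (Glue.inl _ _ p) = Glue.inl _ _ a := fun a => by
      rcases Glue.exists_rep (χ.symm (Glue.inl _ _ a)) with ⟨p, hp⟩ | ⟨b, hb⟩
      · exact ⟨p, by rw [← hp, χ.apply_symm_apply]⟩
      · have e := (χ.symm_apply_eq.mp hb).trans (hτ b)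
        obtain ⟨z, rfl⟩ := Glue.mem_range_left e
        exact ⟨_, (hy z).trans (Glue.condition ε.lout ρ.lin z).symm⟩
    choose σ hσ using ha
    choose r hr using fun w : ω.comp => w.2
    have hr_inj : Function.Injective r := fun w w' hw =>
      Subtype.ext (injr ((hr w).symm.trans
        ((congrArg (fun p => χ (Glue.inl _ _ p)) hw).trans (hr w'))))
    refine trans_equivalent_of_lout_injective hε1 σ r (fun z => ?_) hr_inj (fun a a' haa ha _ => ?_)
      (fun a w haw => ?_) (fun p => ?_) (fun z => ?_) (fun z => ?_) (fun w => ?_) fun a ha => ?_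
    · exact injl (χ.injective ((hσ _).trans ((Glue.condition ε.lout ρ.lin z).trans
        (hr (ω.lin z)).symm)))
    · exact Glue.eq_of_inl_eq ha ((hσ a).symm.trans
        ((congrArg (fun p => χ (Glue.inl _ _ p)) haa).trans (hσ a')))
    · exact Glue.mem_range_left
        ((hσ a).symm.trans ((congrArg (fun p => χ (Glue.inl _ _ p)) haw).trans (hr w)))
    · rcases Glue.exists_rep (χ (Glue.inl _ _ p)) with ⟨a, ha⟩ | ⟨c, hc⟩
      · exact Or.inl ⟨a, injl (χ.injective ((hσ a).trans ha.symm))⟩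
      · exact Or.inr ⟨⟨c, p, hc⟩, injl (χ.injective ((hr ⟨c, p, hc⟩).trans hc.symm))⟩
    · exact injl (χ.injective ((hσ _).trans (h1 z).symm))
    · exact injl (χ.injective ((hr (ω.lout z)).trans (hx' z).symm))
    -- Passing to `π.trans μ` leaves the genus of `π` unchanged; in `ε.trans ρ` the same component
    -- has the genus of `ρ` plus the genera of `ε` attached to it.
    · have e1 := h3 (Glue.inl _ _ (r w))
      rw [hr, hμ.genus_trans_inl] at e1
      rw [← e1, genus_trans_inr ρ hε1]
      congr 1
      exact fiberSum_comp_injective Subtype.val_injective ω.lin _ w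
    · have e1 := h3 (Glue.inl _ _ (σ a))
      rw [hσ, hμ.genus_trans_inl, genus_trans_inl_of_notMem ε ρ ha] at e1
      exact e1.symm
  · refine trans_equivalent_of_lin_injective hμ.1 Subtype.val τ (fun z => rfl) Subtype.val_injective
      (fun b b' hbb hb _ => ?_) hmem (fun c => ?_) (fun z => rfl) (fun z => ?_) (fun w => ?_)
      fun b hb => ?_
    · refine Glue.eq_of_inr_eq hb (χ.injective ?_)
      rw [hτ, hτ, hbb]
    · rcases Glue.exists_rep (χ.symm (Glue.inr _ _ c)) with ⟨p, hp⟩ | ⟨b, hb⟩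
      · exact Or.inl ⟨⟨c, p, by rw [← hp, χ.apply_symm_apply]⟩, rfl⟩
      · exact Or.inr ⟨b, injr ((hτ b).symm.trans (χ.symm_apply_eq.mp hb).symm)⟩
    · exact injr ((hτ _).symm.trans (h2 z))
    · simp only [hμ.2.2, Nat.cast_zero, fiberSum_zero, add_zero]
      rfl
    · have e1 := h3 (Glue.inr _ _ b)
      -- An incoming circle of `ρ` on `τ b` would put `τ b` in `ω` and force `b` to be glued.
      have e2 : fiberSum ρ.lin (fun z => (ε.genus (ε.lout z) : ℤ)) (τ b) = 0 :=
        fiberSum_of_empty (Set.eq_empty_of_forall_notMem fun z hz => hb (hmem (ω.lin z) b hz)) _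
      have e3 := genus_trans_inr ρ hε1 (τ b)
      rw [hτ, genus_trans_inr_of_notMem π μ hb] at e1
      rw [e2, e1] at e3
      omega

end Surface

/-! ### The factorization system on `TwoCob` -/

namespace TwoCob

theorem isOrthogonalFactorizationSystem :
    IsOrthogonalFactorizationSystem cofibrations.{u} fibrations.{u} where
  left_comp f g := Quotient.inductionOn₂ f g fun _ _ => Surface.IsCofibration.trans
  right_comp f g := Quotient.inductionOn₂ f g fun _ _ => Surface.IsFibration.trans
  left_iso f := by
    rintro ⟨g, h1, h2⟩
    induction f, g using Quotient.inductionOn₂ with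
    | h φ ψ =>
      obtain ⟨hl, hr, -⟩ := Surface.bijective_of_inverse (Quotient.exact h1) (Quotient.exact h2)
      choose v hv using hl.2
      exact ⟨hr.1, v ∘ φ.lout, funext fun z => (hv _).symm⟩
  right_iso f := by
    rintro ⟨g, h1, h2⟩
    induction f, g using Quotient.inductionOn₂ with
    | h φ ψ =>
      obtain ⟨hl, hr, hg⟩ := Surface.bijective_of_inverse (Quotient.exact h1) (Quotient.exact h2)
      exact ⟨hl.1, hr.2, fun x => hg _⟩
  factor f := by
    induction f using Quotient.inductionOn with
    | h θ =>
      obtain ⟨k, hk, φ, ψ, hφ, hψ, h⟩ := θ.exists_factorization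
      exact ⟨⟨k⟩, ⟦φ⟧, ⟦ψ⟧, hφ, hψ, Quotient.sound h⟩
  lift e m p q he hm h := by
    induction e, m using Quotient.inductionOn₂ with
    | h ε μ => induction p, q using Quotient.inductionOn₂ with
      | h π ρ =>
        obtain ⟨ω, h1, h2⟩ := Surface.exists_lift he hm (Quotient.exact h)
        refine ⟨⟦ω⟧, ⟨Quotient.sound h1, Quotient.sound h2⟩, fun w hw => ?_⟩
        induction w using Quotient.inductionOn with
        | h ω' =>
          -- The triangle with the fibration alone determines the filler.
          exact Quotient.sound (hm.cancel ((Quotient.exact hw.2).trans h2.symm))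

end TwoCob

/-! ### Oriented curves and their images under `Φ` -/

namespace Curve

variable {M N K : OneCob.{u}}

/-- A component with an incoming and an outgoing point is a segment between two points of the same
sign. -/
theorem exists_of_mem_range (φ : Curve M N) {c : φ.comp} (h : c ∈ Set.range φ.lin)
    (h' : c ∈ Set.range φ.lout) : ∃ a b, M.sign a = N.sign b ∧
      φ.lin ⁻¹' {c} = {a} ∧ φ.lout ⁻¹' {c} = {b} := by
  have e1 := mt Set.preimage_singleton_eq_empty.mp (not_not.mpr h)
  have e2 := mt Set.preimage_singleton_eq_empty.mp (not_not.mpr h')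
  rcases φ.oriented c with ⟨a, b, -, -, -, h2⟩ | ⟨a, b, -, -, h1, -⟩ | ⟨a, b, h1, h2, h3, h4⟩ |
    ⟨a, b, h1, h2, h3, h4⟩ | ⟨h1, -⟩
  · exact absurd h2 e2
  · exact absurd h1 e1
  · exact ⟨a, b, h1.trans h2.symm, h3, h4⟩
  · exact ⟨a, b, h1.trans h2.symm, h3, h4⟩
  · exact absurd h1 e1

theorem orientedAt_of_eq {C : Type u} {lin : M.points → C} {lout : N.points → C} {c : C} {a b}
    (h : M.sign a = N.sign b) (h1 : lin ⁻¹' {c} = {a}) (h2 : lout ⁻¹' {c} = {b}) :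
    OrientedAt M N lin lout c := by
  rcases ha : M.sign a
  · exact Or.inr (Or.inr (Or.inl ⟨a, b, ha, h ▸ ha, h1, h2⟩))
  · exact Or.inr (Or.inr (Or.inr (Or.inl ⟨a, b, ha, h ▸ ha, h1, h2⟩)))

/-- Otherwise the component would be a segment between two outgoing points of opposite signs, which
injectivity would identify. Thus the second condition on a cofibration of surfaces is automatic for
curves. -/
theorem NoCreation.mem_range_lin {φ : Curve M N} (h : φ.NoCreation) (y : N.points) :
    φ.lout y ∈ Set.range φ.lin := by
  have hy : φ.lout ⁻¹' {φ.lout y} = {y} := by ext z; simp [Function.Injective.eq_iff h]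
  rcases φ.oriented (φ.lout y) with ⟨a, b, -, -, -, h2⟩ | ⟨a, b, ha, hb, -, h2⟩ |
    ⟨a, b, -, -, h1, -⟩ | ⟨a, b, -, -, h1, -⟩ | ⟨-, h2⟩
  · simp [hy] at h2
  · have e1 : a ∈ ({y} : Set N.points) := hy ▸ h2 ▸ by simp
    have e2 : b ∈ ({y} : Set N.points) := hy ▸ h2 ▸ by simp
    rw [Set.mem_singleton_iff] at e1 e2
    rw [e1] at ha
    rw [e2, ha] at hb
    cases hb
  · exact ⟨a, (Set.ext_iff.mp h1 a).mpr rfl⟩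
  · exact ⟨a, (Set.ext_iff.mp h1 a).mpr rfl⟩
  · simp [hy] at h2

theorem NoAnnihilation.mem_range_lout {φ : Curve M N} (h : φ.NoAnnihilation) (x : M.points) :
    φ.lin x ∈ Set.range φ.lout := by
  have hx : φ.lin ⁻¹' {φ.lin x} = {x} := by ext z; simp [Function.Injective.eq_iff h]
  rcases φ.oriented (φ.lin x) with ⟨a, b, ha, hb, h2, -⟩ | ⟨a, b, -, -, h2, -⟩ |
    ⟨a, b, -, -, -, h1⟩ | ⟨a, b, -, -, -, h1⟩ | ⟨h2, -⟩
  · have e1 : a ∈ ({x} : Set M.points) := hx ▸ h2 ▸ by simp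
    have e2 : b ∈ ({x} : Set M.points) := hx ▸ h2 ▸ by simp
    rw [Set.mem_singleton_iff] at e1 e2
    rw [e1] at ha
    rw [e2, ha] at hb
    cases hb
  · simp [hx] at h2
  · exact ⟨b, (Set.ext_iff.mp h1 b).mpr rfl⟩
  · exact ⟨b, (Set.ext_iff.mp h1 b).mpr rfl⟩
  · simp [hx] at h2

theorem isCofibration_toSurface (φ : Curve M N) : φ.toSurface.IsCofibration ↔ φ.NoCreation := by
  refine ⟨fun h => h.1, fun h => ⟨h, ?_⟩⟩
  choose v hv using h.mem_range_lin
  exact ⟨v, funext fun y => (hv y).symm⟩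

/-- Without annihilation every incoming point is joined to an outgoing one, so without loops `lout`
is surjective; the genus condition is automatic because only loops have genus one. -/
theorem isFibration_toSurface (φ : Curve M N) :
    φ.toSurface.IsFibration ↔ φ.NoAnnihilation ∧ φ.NoLoops := by
  refine ⟨fun h => ⟨h.1, fun c => Or.inr (h.2.1 c)⟩, fun h => ⟨h.1, fun c => ?_, fun x => ?_⟩⟩
  · rcases h.2 c with ⟨x, rfl⟩ | hc
    · exact h.1.mem_range_lout x
    · exact hc
  · exact if_pos (Or.inl ⟨x, rfl⟩)

/-- Every oriented one-dimensional cobordism is the composition of one with no creation and one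
with neither annihilation nor closed loops. -/
theorem exists_factorization (θ : Curve M N) :
    ∃ (K : OneCob.{u}) (φ : Curve M K) (ψ : Curve K N),
      φ.NoCreation ∧ (ψ.NoAnnihilation ∧ ψ.NoLoops) ∧ (φ.trans ψ).Equivalent θ := by
  let p : θ.comp → Prop := fun c => c ∈ Set.range θ.lin ∨ c ∉ Set.range θ.lout
  let q : θ.comp → Prop := fun c => c ∈ Set.range θ.lout
  have hpq : ∀ c, p c ∨ q c := fun c => by simp only [p, q]; tauto
  have hseg : ∀ z : {c // p c ∧ q c}, ∃ a b, M.sign a = N.sign b ∧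
      θ.lin ⁻¹' {z.1} = {a} ∧ θ.lout ⁻¹' {z.1} = {b} := fun z =>
    θ.exists_of_mem_range (z.2.1.resolve_right (not_not.mpr z.2.2)) z.2.2
  choose s t hst hs ht using hseg
  -- A middle point cuts a segment whose two ends have equal sign, and it inherits that sign.
  let K : OneCob.{u} := { points := {c // p c ∧ q c}, sign := fun z => M.sign (s z) }
  let φ : Curve M K :=
    { comp := {c // p c}
      lin := fun x => ⟨θ.lin x, Or.inl ⟨x, rfl⟩⟩
      lout := fun z => ⟨z.1, z.2.1⟩
      oriented := fun c => by
        have e1 : (fun x => (⟨θ.lin x, Or.inl ⟨x, rfl⟩⟩ : {c // p c})) ⁻¹' {c}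
            = θ.lin ⁻¹' {c.1} := by ext x; simp [Subtype.ext_iff]
        by_cases hc : q c.1
        · refine orientedAt_of_eq (a := s ⟨c.1, c.2, hc⟩) (b := ⟨c.1, c.2, hc⟩) rfl
            (e1.trans (hs ⟨c.1, c.2, hc⟩)) ?_
          ext z
          exact ⟨fun h => Subtype.ext (congrArg (fun x : {c // p c} => x.1) h),
            fun h => Subtype.ext (congrArg (fun x : {c // p c ∧ q c} => x.1) h)⟩
        · have e2 : (fun z : K.points => (⟨z.1, z.2.1⟩ : {c // p c})) ⁻¹' {c} = ∅ :=
            Set.eq_empty_of_forall_notMem fun z hz => hc (congrArg Subtype.val hz ▸ z.2.2)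
          have e3 : θ.lout ⁻¹' {c.1} = ∅ := Set.preimage_singleton_eq_empty.mpr hc
          rcases θ.oriented c.1 with ⟨a, b, ha, hb, h1, -⟩ | ⟨a, b, -, -, -, h2⟩ |
            ⟨a, b, -, -, -, h2⟩ | ⟨a, b, -, -, -, h2⟩ | ⟨h1, -⟩
          · exact Or.inl ⟨a, b, ha, hb, e1.trans h1, e2⟩
          · exact absurd (e3.symm.trans h2).symm (Set.insert_nonempty a {b}).ne_empty
          · simp [e3] at h2
          · simp [e3] at h2
          · exact Or.inr (Or.inr (Or.inr (Or.inr ⟨e1.trans h1, e2⟩))) }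
  let ψ : Curve K N :=
    { comp := {c // q c}
      lin := fun z => ⟨z.1, z.2.2⟩
      lout := fun y => ⟨θ.lout y, y, rfl⟩
      oriented := fun c => by
        have e1 : (fun y => (⟨θ.lout y, y, rfl⟩ : {c // q c})) ⁻¹' {c}
            = θ.lout ⁻¹' {c.1} := by ext x; simp [Subtype.ext_iff]
        by_cases hc : p c.1
        · refine orientedAt_of_eq (a := ⟨c.1, hc, c.2⟩) (b := t ⟨c.1, hc, c.2⟩) (hst _) ?_
            (e1.trans (ht ⟨c.1, hc, c.2⟩))
          ext z
          exact ⟨fun h => Subtype.ext (congrArg (fun x : {c // q c} => x.1) h),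
            fun h => Subtype.ext (congrArg (fun x : {c // p c ∧ q c} => x.1) h)⟩
        · have e2 : (fun z : K.points => (⟨z.1, z.2.2⟩ : {c // q c})) ⁻¹' {c} = ∅ :=
            Set.eq_empty_of_forall_notMem fun z hz => hc (congrArg Subtype.val hz ▸ z.2.1)
          have e3 : θ.lin ⁻¹' {c.1} = ∅ :=
            Set.preimage_singleton_eq_empty.mpr fun h => hc (Or.inl h)
          rcases θ.oriented c.1 with ⟨a, b, -, -, h2, -⟩ | ⟨a, b, ha, hb, -, h1⟩ |
            ⟨a, b, -, -, h2, -⟩ | ⟨a, b, -, -, h2, -⟩ | ⟨-, h1⟩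
          · exact absurd (e3.symm.trans h2).symm (Set.insert_nonempty a {b}).ne_empty
          · exact Or.inr (Or.inl ⟨a, b, ha, hb, e2, e1.trans h1⟩)
          · simp [e3] at h2
          · simp [e3] at h2
          · exact Or.inr (Or.inr (Or.inr (Or.inr ⟨e2, e1.trans h1⟩))) }
  exact ⟨K, φ, ψ, fun x y h => Subtype.ext (congrArg (fun c : {c // p c} => c.1) h),
    ⟨fun x y h => Subtype.ext (congrArg (fun c : {c // q c} => c.1) h),
      fun ⟨c, y, hy⟩ => Or.inr ⟨y, Subtype.ext hy⟩⟩,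
    Glue.subtypeEquiv hpq, fun _ => rfl, fun _ => rfl⟩

/-- A surface cobordism whose composition with a fibration of oriented curves is of the form
`θ.toSurface` is itself of this form. -/
theorem exists_toSurface_equivalent (ω : Surface M.points K.points) {μ : Curve K N}
    {θ : Curve M N} (hμ : μ.toSurface.IsFibration)
    (h : (ω.trans μ.toSurface).Equivalent θ.toSurface) :
    ∃ φ : Curve M K, φ.toSurface.Equivalent ω := by
  obtain ⟨χ, h1, h2, h3⟩ := h
  have hinj : Function.Injective fun w => χ (Glue.inl ω.lout μ.lin w) := fun w w' hw =>
    (Glue.inl_eq_inl_iff hμ.1).mp (χ.injective hw)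
  have hlin : ∀ (e : M.points → ℤ) w, fiberSum θ.lin e (χ (Glue.inl _ _ w)) = fiberSum ω.lin e w :=
    fun e w => by
      rw [← fiberSum_comp_injective hinj]
      congr 1
      exact (funext h1).symm
  -- The outgoing points of the composite on `w` are reached through the middle points on `w`, so
  -- the sum is organised by these.
  have hlout : ∀ (e : N.points → ℤ) w, fiberSum θ.lout e (χ (Glue.inl _ _ w))
      = fiberSum ω.lout (fun z => fiberSum μ.lout e (μ.lin z)) w := fun e w => by
    rw [← Glue.fiberSum_inr_inl hμ.1, fiberSum_comp, ← fiberSum_comp_injective χ.injective]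
    congr 1
    exact (funext h2).symm
  have hone : ∀ w, fiberSum θ.lout 1 (χ (Glue.inl _ _ w)) = fiberSum ω.lout 1 w := fun w => by
    rw [hlout]
    congr 1
    funext z
    -- Each middle point continues along a segment of `μ` to exactly one outgoing point.
    obtain ⟨a, b, -, -, hb⟩ := μ.exists_of_mem_range ⟨z, rfl⟩ (hμ.2.1 (μ.lin z))
    exact fiberSum_of_single hb 1
  have hsign : ∀ w, N.signSum θ.lout (χ (Glue.inl _ _ w)) = K.signSum ω.lout w := fun w => by
    unfold OneCob.signSum
    rw [hlout]
    congr 1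
    funext z
    have e := ((orientedAt_iff _ _ _ _ _).mp (μ.oriented (μ.lin z))).2
    unfold OneCob.signSum at e
    rw [← e, fiberSum_injective hμ.1]
  let φ : Curve M K :=
    { comp := ω.comp
      lin := ω.lin
      lout := ω.lout
      oriented := fun w => by
        -- Point counts and sign sums on `w` agree with those in `θ`, so the numerical criterion
        -- transfers; below, the count also forces the genus.
        have e := (orientedAt_iff _ _ _ _ _).mp (θ.oriented (χ (Glue.inl _ _ w)))
        rw [hlin, hone, hsign] at e
        unfold OneCob.signSum at e
        rw [hlin] at e
        exact (orientedAt_iff _ _ _ _ _).mpr e }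
  refine ⟨φ, Surface.equivalent_of_excess (Equiv.refl _) (fun _ => rfl) (fun _ => rfl) fun w => ?_⟩
  have e1 := φ.two_mul_excess w
  have e2 := θ.two_mul_excess (χ (Glue.inl _ _ w))
  rw [hlin, hone] at e2
  have e3 : ω.excess w = θ.toSurface.excess (χ (Glue.inl _ _ w)) := by
    have e4 := h3 (Glue.inl _ _ w)
    rw [hμ.genus_trans_inl] at e4
    exact congrArg (fun g : ℕ => (g : ℤ) - 1) e4.symm
  change ω.excess w = φ.toSurface.excess w
  rw [e3]
  change _ = -(fiberSum ω.lin 1 w + fiberSum ω.lout 1 w) at e1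
  linarith

end Curve

/-! ### Transfer along `Φ` -/

theorem inverseImage_cofibrations :
    TwoCob.cofibrations.{u}.inverseImage Φ = OneCob.cofibrations.{u} := by
  ext M N f
  induction f using Quotient.inductionOn with
  | h φ => exact φ.isCofibration_toSurface

theorem inverseImage_fibrations :
    TwoCob.fibrations.{u}.inverseImage Φ = OneCob.fibrations.{u} := by
  ext M N f
  induction f using Quotient.inductionOn with
  | h φ => exact φ.isFibration_toSurface

theorem faithful_Φ : Φ.{u}.Faithful where
  map_injective {M N f g} h := by
    induction f, g using Quotient.inductionOn₂ with
    | h φ ψ =>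
      obtain ⟨χ, h1, h2, -⟩ := Quotient.exact h
      exact Quotient.sound ⟨χ, h1, h2⟩

theorem OneCob.exists_factorization {M N : OneCob.{u}} (f : M ⟶ N) :
    ∃ (K : OneCob.{u}) (e : M ⟶ K) (m : K ⟶ N),
      TwoCob.cofibrations (Φ.map e) ∧ TwoCob.fibrations (Φ.map m) ∧ e ≫ m = f := by
  induction f using Quotient.inductionOn with
  | h θ =>
    obtain ⟨K, φ, ψ, hφ, hψ, h⟩ := θ.exists_factorization
    exact ⟨K, ⟦φ⟧, ⟦ψ⟧, φ.isCofibration_toSurface.mpr hφ, ψ.isFibration_toSurface.mpr hψ,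
      Quotient.sound h⟩

/-- This partial fullness of `Φ` is what lets fillers descend to `OneCob`. -/
theorem exists_map_eq_of_comp_fibration {M N K : OneCob.{u}} (w : Φ.obj M ⟶ Φ.obj K) {m : K ⟶ N}
    {f : M ⟶ N} (hm : TwoCob.fibrations (Φ.map m)) (h : w ≫ Φ.map m = Φ.map f) :
    ∃ w' : M ⟶ K, Φ.map w' = w := by
  induction w using Quotient.inductionOn with
  | h ω => induction m, f using Quotient.inductionOn₂ with
    | h μ θ =>
      obtain ⟨φ, hφ⟩ := Curve.exists_toSurface_equivalent ω hm (Quotient.exact h)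
      exact ⟨⟦φ⟧, Quotient.sound hφ⟩

theorem isOrthogonalFactorizationSystem_inverseImage :
    IsOrthogonalFactorizationSystem (TwoCob.cofibrations.{u}.inverseImage Φ)
      (TwoCob.fibrations.{u}.inverseImage Φ) where
  left_comp f g hf hg := by
    rw [MorphismProperty.inverseImage_iff, Φ.map_comp]
    exact TwoCob.isOrthogonalFactorizationSystem.left_comp _ _ hf hg
  right_comp f g hf hg := by
    rw [MorphismProperty.inverseImage_iff, Φ.map_comp]
    exact TwoCob.isOrthogonalFactorizationSystem.right_comp _ _ hf hg
  left_iso f _ := TwoCob.isOrthogonalFactorizationSystem.left_iso (Φ.map f) inferInstance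
  right_iso f _ := TwoCob.isOrthogonalFactorizationSystem.right_iso (Φ.map f) inferInstance
  factor f := OneCob.exists_factorization f
  lift e m p q he hm h := by
    have := faithful_Φ.{u}
    obtain ⟨w, ⟨h1, h2⟩, huniq⟩ := TwoCob.isOrthogonalFactorizationSystem.lift
      (Φ.map e) (Φ.map m) (Φ.map p) (Φ.map q) he hm (by rw [← Φ.map_comp, h, Φ.map_comp])
    -- The filler in `TwoCob` lies in the image of `Φ`; faithfulness then gives the triangles and
    -- uniqueness.
    obtain ⟨w, rfl⟩ := exists_map_eq_of_comp_fibration w hm h2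
    refine ⟨w, ⟨Φ.map_injective (by rw [Φ.map_comp, h1]), Φ.map_injective (by rw [Φ.map_comp, h2])⟩,
      fun w' hw' => Φ.map_injective (huniq _ ⟨?_, ?_⟩)⟩
    · rw [← Φ.map_comp, hw'.1]
    · rw [← Φ.map_comp, hw'.2]

/-- Factorizations are unique up to isomorphism. -/
theorem IsOrthogonalFactorizationSystem.exists_iso {C : Type u} [Category.{v} C]
    {L R : MorphismProperty C} (h : IsOrthogonalFactorizationSystem L R) {X Y Z Z' : C}
    {e : X ⟶ Z} {m : Z ⟶ Y} {e' : X ⟶ Z'} {m' : Z' ⟶ Y} (he : L e) (hm : R m) (he' : L e')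
    (hm' : R m') (heq : e ≫ m = e' ≫ m') : ∃ i : Z ≅ Z', e ≫ i.hom = e' ∧ i.hom ≫ m' = m := by
  obtain ⟨a, ⟨ha1, ha2⟩, -⟩ := h.lift e m' e' m he hm' heq.symm
  obtain ⟨b, ⟨hb1, hb2⟩, -⟩ := h.lift e' m e m' he' hm heq
  -- The composite of the two fillers and the identity both fill the square of `e` against `m`.
  exact ⟨⟨a, b, (h.lift e m e m he hm rfl).unique
      ⟨by rw [← Category.assoc, ha1, hb1], by rw [Category.assoc, hb2, ha2]⟩ ⟨by simp, by simp⟩,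
    (h.lift e' m' e' m' he' hm' rfl).unique
      ⟨by rw [← Category.assoc, hb1, ha1], by rw [Category.assoc, ha2, hb2]⟩ ⟨by simp, by simp⟩⟩,
    ha1, ha2⟩

end Cob

theorem theorem5p4p7 :
    -- an orthogonal factorization system on `2-Cob`
    Cob.IsOrthogonalFactorizationSystem Cob.TwoCob.cofibrations.{u} Cob.TwoCob.fibrations.{u} ∧
    -- its preimage under `Φ` is an orthogonal factorization system on oriented `1-Cob`
    Cob.IsOrthogonalFactorizationSystem
      (Cob.TwoCob.cofibrations.{u}.inverseImage Cob.Φ)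
      (Cob.TwoCob.fibrations.{u}.inverseImage Cob.Φ) ∧
    -- whose classes are given by "no creation" and by "no annihilation and no closed loops"
    Cob.TwoCob.cofibrations.{u}.inverseImage Cob.Φ = Cob.OneCob.cofibrations.{u} ∧
    Cob.TwoCob.fibrations.{u}.inverseImage Cob.Φ = Cob.OneCob.fibrations.{u} ∧
    -- `Φ` is faithful
    Cob.Φ.{u}.Faithful ∧
    -- every factorization of an image lies, up to isomorphism of the middle object, in the image
    ∀ (M N : Cob.OneCob.{u}) (f : M ⟶ N) (K : Cob.TwoCob.{u})
      (e : Cob.Φ.obj M ⟶ K) (m : K ⟶ Cob.Φ.obj N),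
      Cob.TwoCob.cofibrations e → Cob.TwoCob.fibrations m → e ≫ m = Cob.Φ.map f →
      ∃ (K' : Cob.OneCob.{u}) (e' : M ⟶ K') (m' : K' ⟶ N) (i : K ≅ Cob.Φ.obj K'),
        e' ≫ m' = f ∧ Cob.Φ.map e' = e ≫ i.hom ∧ Cob.Φ.map m' = i.inv ≫ m := by
  refine ⟨Cob.TwoCob.isOrthogonalFactorizationSystem,
    Cob.isOrthogonalFactorizationSystem_inverseImage, Cob.inverseImage_cofibrations,
    Cob.inverseImage_fibrations, Cob.faithful_Φ, fun M N f K e m he hm h => ?_⟩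
  -- `K` carries no signs, so `f` is factored in `OneCob` and the image is compared with the given
  -- factorization.
  obtain ⟨K', e', m', he', hm', rfl⟩ := Cob.OneCob.exists_factorization f
  rw [Functor.map_comp] at h
  obtain ⟨i, h1, h2⟩ := Cob.TwoCob.isOrthogonalFactorizationSystem.exists_iso he hm he' hm' h
  exact ⟨K', e', m', i, rfl, h1.symm, by rw [← h2, Iso.inv_hom_id_assoc]⟩
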